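/- Let $n,m\ge 0$ be integers, $T\ge 0$, let $A\subset\mathbb R^m$ be nonempty and compact, and let $f:[0,T]\times\mathbb R^n\times A\to\mathbb R^n$, $L:[0,T]\times\mathbb R^n\times A\to\mathbb R$ and $g:\mathbb R^n\to\mathbb R$ satisfy the following: there are constants $L_f,L_L,L_g$ with $$\|f(s_1,x_1,a)-f(s_2,x_2,a)\|\le L_f(|s_1-s_2|+\|x_1-x_2\|),\quad |L(s_1,x_1,a)-L(s_2,x_2,a)|\le L_L(|s_1-s_2|+\|x_1-x_2\|),\quad |g(x_1)-g(x_2)|\le L_g\|x_1-x_2\|$$ for all $s_1,s_2\in[0,T]$, $x_1,x_2\in\mathbb R^n$, $a\in A$; the maps $a\mapsto f(s,x,a)$ and $a\mapsto L(s,x,a)$ are continuous on $A$ for all $(s,x)\in[0,T]\times\mathbb R^n$; and there is $C\in\mathbb R$ with $L(s,x,a)\ge C$ and $g(x)\ge C$ for all $(s,x,a)$. For $(t,x)\in[0,T]\times\mathbb R^n$ let $$\vartheta(t,x):=\inf\Big\{\int_t^T L(s,\mathrm x(s),\alpha(s))\,ds+g(\mathrm x(T))\Big\},$$ the infimum being over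 all essentially bounded measurable $\alpha:[t,T]\to A$ and absolutely continuous $\mathrm x:[t,T]\to\mathbb R^n$ with $\mathrm x(t)=x$ and $\dot{\mathrm x}(s)=f(s,\mathrm x(s),\alpha(s))$ for a.e. $s\in[t,T]$. Put $$H(s,x,p):=\max_{a\in A}\,[-p\cdot f(s,x,a)-L(s,x,a)],\qquad H^*(s,x,b):=\sup_{p\in\mathbb R^n}[p\cdot b-H(s,x,p)]\in\mathbb R\cup\{+\infty\},\qquad B(s,x):=\{-f(s,x,a): a\in A\},$$ and let $$\bar\vartheta(t,x):=\inf\Big\{\int_t^T H^*(s,\mathrm x(s),\beta(s))\,ds+g(\mathrm x(T))\Big\},$$ the infimum being over all $\beta:[t,T]\to\mathbb R^n$ and absolutely continuous $\mathrm x:[t,T]\to\mathbb R^n$ with $\mathrm x(t)=x$, $\dot{\mathrm x}(s)=-\beta(s)$ for a.e. $s\in[t,T]$, and $\beta(s)\in\mathrm{Conv}(B(s,\mathrm x(s)))$ for all $s\in[t,T]$. Then for all $(t,x)\in[0,T]\times\mathbb R^n$: the integrands in both problems are finite and integrable along all admissible pairs, $\vartheta(t,x)$ is finite, and $\vartheta(t,x)=\bar\vartheta(t,x)$.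 -/

import Mathlib

open MeasureTheory Set
open scoped RealInnerProductSpace

namespace LaxFormula

noncomputable section

/-- Euclidean space `ℝᵏ`. -/
abbrev E (k : ℕ) : Type := EuclideanSpace ℝ (Fin k)

variable {n m : ℕ}

/-- `x` and `α` solve the controlled system on `[t, T]`: the control `α` is essentially bounded
(in particular measurable) with values in `A`, the trajectory `x` is absolutely continuous with
`x t = x₀`, and `x' s = f (s, x s, α s)` for almost every `s` in `[t, T]`. -/
structure IsAdmissible (f : ℝ → E n → E m → E n) (A : Set (E m)) (t T : ℝ) (x₀ : E n)
    (x : ℝ → E n) (α : ℝ → E m) : Prop where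
  control_bounded : MemLp α ⊤ (volume.restrict (Icc t T))
  control_mem : ∀ s ∈ Icc t T, α s ∈ A
  absCont : AbsolutelyContinuousOnInterval x t T
  initial : x t = x₀
  dynamics : ∀ᵐ s ∂(volume.restrict (Icc t T)), HasDerivAt x (f s (x s) (α s)) s

/-- The cost of a trajectory and a control in the given problem. -/
def cost (L : ℝ → E n → E m → ℝ) (g : E n → ℝ) (t T : ℝ) (x : ℝ → E n) (α : ℝ → E m) : ℝ :=
  (∫ s in t..T, L s (x s) (α s)) + g (x T)

/-- The value function of the state-unconstrained optimal control problem. -/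
def value (f : ℝ → E n → E m → E n) (L : ℝ → E n → E m → ℝ) (g : E n → ℝ) (A : Set (E m))
    (T t : ℝ) (x₀ : E n) : EReal :=
  ⨅ (x : ℝ → E n) (α : ℝ → E m) (_ : IsAdmissible f A t T x₀ x α), ((cost L g t T x α : ℝ) : EReal)

/-- The Hamiltonian `H (s, x, p) = max_{a ∈ A} (- p ⬝ f (s, x, a) - L (s, x, a))`; the supremum is a
maximum when `A` is compact and nonempty and `f`, `L` are continuous in `a`. -/
def hamiltonian (f : ℝ → E n → E m → E n) (L : ℝ → E n → E m → ℝ) (A : Set (E m))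
    (s : ℝ) (x p : E n) : ℝ :=
  sSup ((fun a => -⟪p, f s x a⟫ - L s x a) '' A)

/-- The Legendre-Fenchel transform of the Hamiltonian in `p`,
`H* (s, x, b) = sup_p (p ⬝ b - H (s, x, p))`, with values in the extended reals. -/
def hamiltonianConj (f : ℝ → E n → E m → E n) (L : ℝ → E n → E m → ℝ) (A : Set (E m))
    (s : ℝ) (x b : E n) : EReal :=
  ⨆ p : E n, ((⟪p, b⟫ - hamiltonian f L A s x p : ℝ) : EReal)

/-- The transformed control set `B (s, x) = {- f (s, x, a) | a ∈ A}`. -/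
def velocitySet (f : ℝ → E n → E m → E n) (A : Set (E m)) (s : ℝ) (x : E n) : Set (E n) :=
  {b | ∃ a ∈ A, b = -f s x a}

/-- `x` and `β` satisfy the constraints of the Lax problem on `[t, T]`: `x` is absolutely continuous
with `x t = x₀`, `x' s = - β s` for almost every `s` in `[t, T]`, and `β s` lies in the convex hull
of `B (s, x s)`. (Measurability of `β` up to a null set follows, as `β` is `-x'` almost
everywhere.) -/
structure IsLaxAdmissible (f : ℝ → E n → E m → E n) (A : Set (E m)) (t T : ℝ) (x₀ : E n)
    (x β : ℝ → E n) : Prop where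
  absCont : AbsolutelyContinuousOnInterval x t T
  initial : x t = x₀
  dynamics : ∀ᵐ s ∂(volume.restrict (Icc t T)), HasDerivAt x (-β s) s
  control_mem : ∀ s ∈ Icc t T, β s ∈ convexHull ℝ (velocitySet f A s (x s))

/-- The cost in the Lax problem. On the convex hull of `B (s, x)` the conjugate `H*` is finite. -/
def laxCost (f : ℝ → E n → E m → E n) (L : ℝ → E n → E m → ℝ) (g : E n → ℝ) (A : Set (E m))
    (t T : ℝ) (x β : ℝ → E n) : ℝ :=
  (∫ s in t..T, (hamiltonianConj f L A s (x s) (β s)).toReal) + g (x T)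

/-- The right-hand side of the generalized Lax formula. -/
def laxValue (f : ℝ → E n → E m → E n) (L : ℝ → E n → E m → ℝ) (g : E n → ℝ) (A : Set (E m))
    (T t : ℝ) (x₀ : E n) : EReal :=
  ⨅ (x : ℝ → E n) (β : ℝ → E n) (_ : IsLaxAdmissible f A t T x₀ x β),
    ((laxCost f L g A t T x β : ℝ) : EReal)

end

end LaxFormula

/-! One inequality is direct: an admissible pair yields a Lax pair with velocity `-f s (x s) (α s)`,
and there `H*` is at most `L` (`IsAdmissible.laxCost_le_cost`).

The other is a relaxation argument, carried out without measurable selection. By duality, `(-b,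
H*(s, x, b))` lies in the closure of the points above the convex hull of the pairs `(f s x a, L s x
a)`: a separating functional would have a nonnegative cost coefficient, and such functionals are
controlled by the definition of `H*` (`exists_inner_add_mul_le`, `mem_closure_of_forall_exists_le`).
Given a Lax trajectory, cut `[t, T]` into steps of length `h`. On a step the mean of `(-β, H*)`
lies, up to `O(h)`, above the convex hull frozen at the left end (`exists_mem_convexHull_average`).
Splitting time in proportion to the weights realises a point of this hull by piecewise constant
controls (`exists_reach_of_mem_convexHull`). A step starting at distance `e` from the Lax trajectory
costs an error `h * O(h + e)`, so a discrete Gronwall argument gives a total error `O(h)` in the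
endpoint and in the running cost (`exists_reach_grid`). Since `g` is Lipschitz, `h → 0` finishes.

The value is finite because `C` bounds the data below and constant controls on short intervals can
be concatenated. -/

namespace LaxFormula

/-- The standing assumptions on the dynamics and the running cost, with a common positive Lipschitz
constant. -/
structure ControlData {n m : ℕ} (T : ℝ) (A : Set (E m)) (f : ℝ → E n → E m → E n)
    (L : ℝ → E n → E m → ℝ) (Λ : ℝ) : Prop where
  pos : 0 < Λ
  isCompact : IsCompact A
  nonempty : A.Nonempty
  lip_f : ∀ a ∈ A, ∀ s₁ ∈ Icc 0 T, ∀ s₂ ∈ Icc 0 T, ∀ x₁ x₂ : E n,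
    ‖f s₁ x₁ a - f s₂ x₂ a‖ ≤ Λ * (|s₁ - s₂| + ‖x₁ - x₂‖)
  lip_L : ∀ a ∈ A, ∀ s₁ ∈ Icc 0 T, ∀ s₂ ∈ Icc 0 T, ∀ x₁ x₂ : E n,
    ‖L s₁ x₁ a - L s₂ x₂ a‖ ≤ Λ * (|s₁ - s₂| + ‖x₁ - x₂‖)
  cont_f : ∀ s ∈ Icc 0 T, ∀ x : E n, ContinuousOn (f s x) A
  cont_L : ∀ s ∈ Icc 0 T, ∀ x : E n, ContinuousOn (L s x) A

/-! ### Joint continuity and linear growth of the data -/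

section Joint

variable {n m : ℕ} {T Λ : ℝ} {A : Set (E m)} {G : Type*} [NormedAddCommGroup G]
  {F : ℝ → E n → E m → G}

theorem continuousOn_joint (hΛ : 0 < Λ)
    (hF : ∀ a ∈ A, ∀ s₁ ∈ Icc 0 T, ∀ s₂ ∈ Icc 0 T, ∀ x₁ x₂ : E n,
      ‖F s₁ x₁ a - F s₂ x₂ a‖ ≤ Λ * (|s₁ - s₂| + ‖x₁ - x₂‖))
    (hc : ∀ s ∈ Icc 0 T, ∀ x : E n, ContinuousOn (F s x) A) :
    ContinuousOn (fun z : ℝ × E n × E m => F z.1 z.2.1 z.2.2) (Icc 0 T ×ˢ univ ×ˢ A) := by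
  rintro ⟨s, x, a⟩ ⟨hs, -, ha⟩
  simp only at hs ha
  rw [Metric.continuousWithinAt_iff]
  intro ε hε
  obtain ⟨δ, hδ, h⟩ := Metric.continuousWithinAt_iff.1 (hc s hs x a ha) (ε / 2) (by positivity)
  refine ⟨min δ (ε / (4 * Λ)), by positivity, ?_⟩
  rintro ⟨s', x', a'⟩ ⟨hs', -, ha'⟩ hd
  simp only at hs' ha' ⊢
  rw [Prod.dist_eq, Prod.dist_eq] at hd
  simp only [max_lt_iff, lt_min_iff] at hd
  obtain ⟨⟨-, -, h3⟩, h1, h2, -⟩ := hd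
  have h4 := h ha' h3
  rw [dist_eq_norm] at h1 h2 h4 ⊢
  rw [Real.norm_eq_abs] at h1
  have h5 := hF a' ha' s' hs' s hs x' x
  have h6 : Λ * (|s' - s| + ‖x' - x‖) < Λ * (ε / (4 * Λ) + ε / (4 * Λ)) := by gcongr
  have h7 : Λ * (ε / (4 * Λ) + ε / (4 * Λ)) = ε / 2 := by field_simp; ring
  calc ‖F s' x' a' - F s x a‖ = ‖(F s' x' a' - F s x a') + (F s x a' - F s x a)‖ := by
        congr 1; abel
    _ ≤ ‖F s' x' a' - F s x a'‖ + ‖F s x a' - F s x a‖ := norm_add_le _ _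
    _ < ε := by linarith

theorem exists_linear_growth (hΛ : 0 < Λ) (hT : 0 ≤ T) (hA : IsCompact A)
    (hF : ∀ a ∈ A, ∀ s₁ ∈ Icc 0 T, ∀ s₂ ∈ Icc 0 T, ∀ x₁ x₂ : E n,
      ‖F s₁ x₁ a - F s₂ x₂ a‖ ≤ Λ * (|s₁ - s₂| + ‖x₁ - x₂‖))
    (hc : ∀ s ∈ Icc 0 T, ∀ x : E n, ContinuousOn (F s x) A) :
    ∃ K, 0 < K ∧ ∀ s ∈ Icc 0 T, ∀ x, ∀ a ∈ A, ‖F s x a‖ ≤ K * (1 + ‖x‖) := by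
  have h0 : (0 : ℝ) ∈ Icc 0 T := ⟨le_rfl, hT⟩
  obtain ⟨K₀, hK₀⟩ := hA.exists_bound_of_continuousOn (hc 0 h0 0)
  refine ⟨|K₀| + Λ * T + Λ, by positivity, fun s hs x a ha => ?_⟩
  have h1 := hF a ha s hs 0 h0 x 0
  have h2 := hK₀ a ha
  have h3 : ‖F s x a‖ ≤ ‖F s x a - F 0 0 a‖ + ‖F 0 0 a‖ := by
    simpa using norm_add_le (F s x a - F 0 0 a) (F 0 0 a)
  rw [sub_zero, sub_zero, abs_of_nonneg hs.1] at h1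
  have h4 : Λ * (s + ‖x‖) ≤ Λ * (T + ‖x‖) := by gcongr; exact hs.2
  have h5 : 0 ≤ (|K₀| + Λ * T) * ‖x‖ := by positivity
  nlinarith [le_abs_self K₀]

end Joint

/-! ### The Hamiltonian and its conjugate -/

section Hamiltonian

variable {n m : ℕ} {T Λ : ℝ} {A : Set (E m)} {f : ℝ → E n → E m → E n}
  {L : ℝ → E n → E m → ℝ}

namespace ControlData

variable (D : ControlData T A f L Λ)
include D

theorem exists_hamiltonian_eq {s : ℝ} (hs : s ∈ Icc 0 T) (x p : E n) :
    ∃ a ∈ A, hamiltonian f L A s x p = -⟪p, f s x a⟫ - L s x a ∧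
      ∀ a' ∈ A, -⟪p, f s x a'⟫ - L s x a' ≤ -⟪p, f s x a⟫ - L s x a := by
  have hc : ContinuousOn (fun a => -⟪p, f s x a⟫ - L s x a) A :=
    ((continuousOn_const.inner (D.cont_f s hs x)).neg).sub (D.cont_L s hs x)
  obtain ⟨a, ha, h1, h2⟩ := D.isCompact.exists_sSup_image_eq_and_ge D.nonempty hc
  exact ⟨a, ha, h1, h2⟩

theorem le_hamiltonian {s : ℝ} (hs : s ∈ Icc 0 T) (x p : E n) {a : E m} (ha : a ∈ A) :
    -⟪p, f s x a⟫ - L s x a ≤ hamiltonian f L A s x p := by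
  obtain ⟨a', -, h1, h2⟩ := D.exists_hamiltonian_eq hs x p
  rw [h1]
  exact h2 a ha

theorem hamiltonian_le {s : ℝ} (hs : s ∈ Icc 0 T) (x p : E n) {c : ℝ}
    (hc : ∀ a ∈ A, -⟪p, f s x a⟫ - L s x a ≤ c) : hamiltonian f L A s x p ≤ c := by
  obtain ⟨a', ha', h1, -⟩ := D.exists_hamiltonian_eq hs x p
  rw [h1]
  exact hc a' ha'

/-- A maximum of functions with a common Lipschitz constant inherits that constant. -/
theorem hamiltonian_sub_le {s₁ s₂ : ℝ} (hs₁ : s₁ ∈ Icc 0 T) (hs₂ : s₂ ∈ Icc 0 T) (x₁ x₂ p : E n) :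
    hamiltonian f L A s₁ x₁ p - hamiltonian f L A s₂ x₂ p
      ≤ (‖p‖ + 1) * Λ * (|s₁ - s₂| + ‖x₁ - x₂‖) := by
  rw [sub_le_iff_le_add]
  refine D.hamiltonian_le hs₁ x₁ p fun a ha => ?_
  have h1 := D.le_hamiltonian hs₂ x₂ p ha
  have h2 := D.lip_f a ha s₁ hs₁ s₂ hs₂ x₁ x₂
  have h3 := (abs_le.1 (D.lip_L a ha s₁ hs₁ s₂ hs₂ x₁ x₂)).1
  have h4 := (abs_le.1 (abs_real_inner_le_norm p (f s₁ x₁ a - f s₂ x₂ a))).1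
  rw [inner_sub_right] at h4
  have h5 : ‖p‖ * ‖f s₁ x₁ a - f s₂ x₂ a‖ ≤ ‖p‖ * (Λ * (|s₁ - s₂| + ‖x₁ - x₂‖)) := by gcongr
  linarith

theorem continuousOn_hamiltonian (p : E n) :
    ContinuousOn (fun z : ℝ × E n => hamiltonian f L A z.1 z.2 p) (Icc 0 T ×ˢ univ) := by
  have hΛ := D.pos
  refine (LipschitzOnWith.of_dist_le_mul (K := .mk ((‖p‖ + 1) * Λ * 2) (by positivity)) ?_).continuousOn
  rintro ⟨s₁, x₁⟩ ⟨hs₁, -⟩ ⟨s₂, x₂⟩ ⟨hs₂, -⟩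
  simp only at hs₁ hs₂
  have key : ∀ {s₁ s₂ : ℝ} (_ : s₁ ∈ Icc 0 T) (_ : s₂ ∈ Icc 0 T) (x₁ x₂ : E n),
      hamiltonian f L A s₁ x₁ p - hamiltonian f L A s₂ x₂ p
        ≤ (‖p‖ + 1) * Λ * 2 * dist (s₁, x₁) (s₂, x₂) := by
    intro s₁ s₂ hs₁ hs₂ x₁ x₂
    refine (D.hamiltonian_sub_le hs₁ hs₂ x₁ x₂ p).trans ?_
    have h1 : dist s₁ s₂ ≤ dist (s₁, x₁) (s₂, x₂) := le_max_left _ _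
    have h2 : dist x₁ x₂ ≤ dist (s₁, x₁) (s₂, x₂) := le_max_right _ _
    rw [Real.dist_eq] at h1
    rw [dist_eq_norm] at h2
    rw [mul_assoc _ (2 : ℝ)]
    gcongr
    linarith
  rw [Real.dist_eq, NNReal.coe_mk]
  refine abs_sub_le_iff.2 ⟨key hs₁ hs₂ x₁ x₂, ?_⟩
  rw [dist_comm]
  exact key hs₂ hs₁ x₂ x₁

theorem continuous_hamiltonian {s : ℝ} (hs : s ∈ Icc 0 T) (x : E n) :
    Continuous (hamiltonian f L A s x) := by
  obtain ⟨K, hK⟩ := D.isCompact.exists_bound_of_continuousOn (D.cont_f s hs x)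
  have key : ∀ p₁ p₂ : E n, hamiltonian f L A s x p₁ - hamiltonian f L A s x p₂
      ≤ |K| * dist p₁ p₂ := by
    intro p₁ p₂
    rw [sub_le_iff_le_add]
    refine D.hamiltonian_le hs x p₁ fun a ha => ?_
    have h1 := D.le_hamiltonian hs x p₂ ha
    have h4 := (abs_le.1 (abs_real_inner_le_norm (p₁ - p₂) (f s x a))).1
    rw [inner_sub_left] at h4
    have h5 : ‖p₁ - p₂‖ * ‖f s x a‖ ≤ ‖p₁ - p₂‖ * |K| := by
      gcongr
      exact (hK a ha).trans (le_abs_self K)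
    rw [dist_eq_norm]
    linarith
  refine (LipschitzWith.of_dist_le_mul (K := .mk |K| (abs_nonneg K)) fun p₁ p₂ => ?_).continuous
  rw [Real.dist_eq, NNReal.coe_mk]
  refine abs_sub_le_iff.2 ⟨key p₁ p₂, ?_⟩
  rw [dist_comm]
  exact key p₂ p₁

/-- A linear functional on a convex hull is bounded by its maximum over the generators, attained
here by compactness of `A`. -/
theorem exists_inner_add_le_of_mem_convexHull {s : ℝ} (hs : s ∈ Icc 0 T) {x b : E n}
    (hb : b ∈ convexHull ℝ (velocitySet f A s x)) (q : E n) :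
    ∃ a ∈ A, ⟪q, f s x a⟫ ≤ -⟪q, b⟫ := by
  obtain ⟨a, ha, h⟩ := D.isCompact.exists_isMinOn D.nonempty
    ((continuousOn_const (c := q)).inner (D.cont_f s hs x) (𝕜 := ℝ))
  refine ⟨a, ha, ?_⟩
  have hsub : convexHull ℝ (velocitySet f A s x) ⊆ {b | ⟪q, b⟫ ≤ -⟪q, f s x a⟫} := by
    refine convexHull_min ?_ (convex_halfSpace_le (innerSL ℝ q).isLinear _)
    rintro _ ⟨a', ha', rfl⟩
    have := h ha'
    simp only [mem_ofPred_eq] at this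
    simpa [inner_neg_right] using this
  have := hsub hb
  simp only [mem_ofPred_eq] at this
  linarith

theorem hamiltonianConj_le {s : ℝ} (hs : s ∈ Icc 0 T) {x b : E n} {c : ℝ}
    (hb : b ∈ convexHull ℝ (velocitySet f A s x)) (hc : ∀ a ∈ A, L s x a ≤ c) :
    hamiltonianConj f L A s x b ≤ (c : EReal) := by
  refine iSup_le fun p => EReal.coe_le_coe_iff.2 ?_
  obtain ⟨a, ha, h⟩ := D.exists_inner_add_le_of_mem_convexHull hs hb p
  have := D.le_hamiltonian hs x p ha
  linarith [hc a ha]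

theorem hamiltonianConj_neg_le {s : ℝ} (hs : s ∈ Icc 0 T) {x : E n} {a : E m} (ha : a ∈ A) :
    hamiltonianConj f L A s x (-f s x a) ≤ (L s x a : EReal) := by
  refine iSup_le fun p => EReal.coe_le_coe_iff.2 ?_
  have := D.le_hamiltonian hs x p ha
  rw [inner_neg_right]
  linarith

theorem le_hamiltonianConj {s : ℝ} (hs : s ∈ Icc 0 T) {x b : E n} {c : ℝ}
    (hc : ∀ a ∈ A, c ≤ L s x a) : (c : EReal) ≤ hamiltonianConj f L A s x b := by
  refine le_iSup_of_le (0 : E n) (EReal.coe_le_coe_iff.2 ?_)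
  have : hamiltonian f L A s x 0 ≤ -c := D.hamiltonian_le hs x 0 fun a ha => by
    simpa using hc a ha
  rw [inner_zero_left]
  linarith

theorem hamiltonianConj_ne_bot {s : ℝ} (hs : s ∈ Icc 0 T) (x b : E n) :
    hamiltonianConj f L A s x b ≠ ⊥ := by
  obtain ⟨c, hc⟩ := D.isCompact.exists_bound_of_continuousOn (D.cont_L s hs x)
  exact ((EReal.bot_lt_coe (-c)).trans_le
    (D.le_hamiltonianConj hs fun a ha => (abs_le.1 (hc a ha)).1)).ne'

theorem hamiltonianConj_ne_top {s : ℝ} (hs : s ∈ Icc 0 T) {x b : E n}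
    (hb : b ∈ convexHull ℝ (velocitySet f A s x)) : hamiltonianConj f L A s x b ≠ ⊤ := by
  obtain ⟨c, hc⟩ := D.isCompact.exists_bound_of_continuousOn (D.cont_L s hs x)
  exact ((D.hamiltonianConj_le hs hb fun a ha => (abs_le.1 (hc a ha)).2).trans_lt
    (EReal.coe_lt_top c)).ne

theorem coe_toReal_hamiltonianConj {s : ℝ} (hs : s ∈ Icc 0 T) {x b : E n}
    (hb : b ∈ convexHull ℝ (velocitySet f A s x)) :
    ((hamiltonianConj f L A s x b).toReal : EReal) = hamiltonianConj f L A s x b :=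
  EReal.coe_toReal (D.hamiltonianConj_ne_top hs hb) (D.hamiltonianConj_ne_bot hs x b)

/-- Every functional that is nonnegative in the cost direction is at least as small at some point
`(f (s, x, a), L (s, x, a))` as it is at `(-b, H* (s, x, b))`. -/
theorem exists_inner_add_mul_le {s : ℝ} (hs : s ∈ Icc 0 T) {x b : E n}
    (hb : b ∈ convexHull ℝ (velocitySet f A s x)) (q : E n) {μ : ℝ} (hμ : 0 ≤ μ) :
    ∃ a ∈ A, ⟪q, f s x a⟫ + μ * L s x a
      ≤ ⟪q, -b⟫ + μ * (hamiltonianConj f L A s x b).toReal := by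
  -- For `μ = 0` only membership in the convex hull is needed; for `μ > 0` scaling reduces to the
  -- term `p = μ⁻¹ • q` of the supremum, with `a` a maximiser for that `p`.
  rcases hμ.eq_or_lt with rfl | hμ
  · simpa [inner_neg_right] using D.exists_inner_add_le_of_mem_convexHull hs hb q
  · obtain ⟨a, ha, h1, -⟩ := D.exists_hamiltonian_eq hs x (μ⁻¹ • q)
    refine ⟨a, ha, ?_⟩
    have h2 : ((⟪μ⁻¹ • q, b⟫ - hamiltonian f L A s x (μ⁻¹ • q) : ℝ) : EReal)
        ≤ hamiltonianConj f L A s x b :=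
      le_iSup (fun p : E n => ((⟪p, b⟫ - hamiltonian f L A s x p : ℝ) : EReal)) _
    rw [← D.coe_toReal_hamiltonianConj hs hb, EReal.coe_le_coe_iff, h1, real_inner_smul_left,
      real_inner_smul_left] at h2
    have h3 := mul_le_mul_of_nonneg_left h2 hμ.le
    have h4 : μ * (μ⁻¹ * ⟪q, b⟫ - (-(μ⁻¹ * ⟪q, f s x a⟫) - L s x a))
        = ⟪q, b⟫ + ⟪q, f s x a⟫ + μ * L s x a := by field_simp; ring
    rw [inner_neg_right]
    linarith

end ControlData

end Hamiltonian

/-! ### Integrability along trajectories -/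

section Integrability

variable {n m : ℕ} {T Λ : ℝ} {A : Set (E m)} {f : ℝ → E n → E m → E n}
  {L : ℝ → E n → E m → ℝ}

/-- Boundedness of `v` makes its primitive Lipschitz, hence absolutely continuous; its difference
with `x` has zero derivative a.e. and is constant. -/
theorem _root_.AbsolutelyContinuousOnInterval.integral_eq_sub_of_ae_hasDerivAt {F : Type*}
    [NormedAddCommGroup F] [NormedSpace ℝ F] [CompleteSpace F] {x v : ℝ → F} {a b : ℝ}
    (hx : AbsolutelyContinuousOnInterval x a b) (hv : IntervalIntegrable v volume a b)
    (hd : ∀ᵐ s, s ∈ uIcc a b → HasDerivAt x (v s) s) {M : ℝ}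
    (hM : ∀ s ∈ uIcc a b, ‖v s‖ ≤ M) :
    ∫ s in a..b, v s = x b - x a := by
  have hsub : ∀ {c}, c ∈ uIcc a b → IntervalIntegrable v volume a c := fun hc =>
    hv.mono_set (uIcc_subset_uIcc_left hc)
  have hac : AbsolutelyContinuousOnInterval (fun s => ∫ r in a..s, v r) a b := by
    refine (LipschitzOnWith.of_dist_le_mul (K := .mk |M| (abs_nonneg M))
      fun s hs r hr => ?_).absolutelyContinuousOnInterval
    rw [dist_eq_norm, intervalIntegral.integral_interval_sub_left (hsub hs) (hsub hr),
      Real.dist_eq, NNReal.coe_mk]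
    refine intervalIntegral.norm_integral_le_of_norm_le_const fun u hu => ?_
    exact (hM u (uIcc_subset_uIcc hr hs (uIoc_subset_uIcc hu))).trans (le_abs_self M)
  obtain ⟨c, hc⟩ := (hx.sub hac).const_of_ae_hasDerivAt_zero (by
    filter_upwards [hd, hv.ae_hasDerivAt_integral] with s h1 h2 hs
    simpa using (h1 hs).sub (h2 hs a left_mem_uIcc))
  have h1 := hc a left_mem_uIcc
  have h2 := hc b right_mem_uIcc
  simp only [Pi.sub_apply, intervalIntegral.integral_same, sub_zero] at h1 h2
  rw [← h1] at h2
  rw [sub_eq_iff_eq_add] at h2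
  rw [h2]
  abel

/-- Makes `H*` a countable supremum, hence measurable along a trajectory. -/
theorem iSup_coe_eq_iSup_denseSeq {X : Type*} [TopologicalSpace X]
    [TopologicalSpace.SeparableSpace X] [Nonempty X] {φ : X → ℝ} (hφ : Continuous φ) :
    ⨆ p, (φ p : EReal) = ⨆ k, (φ (TopologicalSpace.denseSeq X k) : EReal) := by
  refine le_antisymm (iSup_le fun p => ?_) (iSup_le fun k => le_iSup (fun p => (φ p : EReal)) _)
  refine (TopologicalSpace.denseRange_denseSeq X).induction_on p
    (isClosed_le (continuous_coe_real_ereal.comp hφ) continuous_const) fun k => ?_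
  exact le_iSup (fun k => (φ (TopologicalSpace.denseSeq X k) : EReal)) k

theorem intervalIntegrable_of_norm_le {F : Type*} [NormedAddCommGroup F] {v : ℝ → F} {a b M : ℝ}
    (hab : a ≤ b) (hv : AEStronglyMeasurable v (volume.restrict (Icc a b)))
    (hM : ∀ s ∈ Icc a b, ‖v s‖ ≤ M) : IntervalIntegrable v volume a b := by
  rw [intervalIntegrable_iff_integrableOn_Icc_of_le hab]
  exact IntegrableOn.of_bound measure_Icc_lt_top hv M
    ((ae_restrict_iff' measurableSet_Icc).2 (Filter.Eventually.of_forall hM))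

namespace ControlData

theorem intervalIntegrable_cost (D : ControlData T A f L Λ) {σ τ : ℝ} (hσ : 0 ≤ σ) (hστ : σ ≤ τ)
    (hτ : τ ≤ T) {x : ℝ → E n} {α : ℝ → E m} (hx : ContinuousOn x (Icc σ τ))
    (hα : AEMeasurable α (volume.restrict (Icc σ τ))) (hαA : ∀ s ∈ Icc σ τ, α s ∈ A) :
    IntervalIntegrable (fun s => L s (x s) (α s)) volume σ τ := by
  have hsub : Icc σ τ ⊆ Icc 0 T := Icc_subset_Icc hσ hτ
  obtain ⟨K, hK, hgr⟩ := exists_linear_growth D.pos (hσ.trans (hστ.trans hτ)) D.isCompact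
    D.lip_L D.cont_L
  obtain ⟨R, hR⟩ := isCompact_Icc.exists_bound_of_continuousOn hx
  refine intervalIntegrable_of_norm_le (M := K * (1 + R)) hστ ?_ fun s hs => ?_
  -- Extending `L` by zero off a closed set on which it is jointly continuous gives a Borel function
  -- on the whole space, which can be composed with an a.e. measurable control.
  · have hm : Measurable ((Icc 0 T ×ˢ (univ : Set (E n)) ×ˢ A).indicator
        fun z : ℝ × E n × E m => L z.1 z.2.1 z.2.2) := by
      classical
      rw [← piecewise_eq_indicator]
      exact (continuousOn_joint D.pos D.lip_L D.cont_L).measurable_piecewise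
        continuousOn_const (measurableSet_Icc.prod
          (MeasurableSet.univ.prod D.isCompact.isClosed.measurableSet))
    have hφ : AEMeasurable (fun s => (s, x s, α s)) (volume.restrict (Icc σ τ)) :=
      aemeasurable_id.prodMk ((hx.aemeasurable measurableSet_Icc).prodMk hα)
    refine (hm.comp_aemeasurable hφ).aestronglyMeasurable.congr ?_
    refine (ae_restrict_iff' measurableSet_Icc).2 (Filter.Eventually.of_forall fun s hs => ?_)
    exact indicator_of_mem (s := Icc 0 T ×ˢ (univ : Set (E n)) ×ˢ A)
      (f := fun z : ℝ × E n × E m => L z.1 z.2.1 z.2.2) (a := (s, x s, α s))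
      ⟨hsub hs, mem_univ _, hαA s hs⟩
  · refine (hgr s (hsub hs) (x s) (α s) (hαA s hs)).trans ?_
    gcongr
    exact hR s hs

end ControlData

namespace IsLaxAdmissible

variable {t : ℝ} {x₀ : E n} {x β : ℝ → E n}

theorem continuousOn (h : IsLaxAdmissible f A t T x₀ x β) (htT : t ≤ T) :
    ContinuousOn x (Icc t T) := by
  simpa [uIcc_of_le htT] using h.absCont.continuousOn

theorem aemeasurable_velocity (h : IsLaxAdmissible f A t T x₀ x β) :
    AEMeasurable β (volume.restrict (Icc t T)) := by
  refine (measurable_deriv x).neg.aemeasurable.congr ?_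
  filter_upwards [h.dynamics] with s hs
  simp [hs.deriv]

theorem exists_norm_velocity_le (h : IsLaxAdmissible f A t T x₀ x β)
    (D : ControlData T A f L Λ) (ht : 0 ≤ t) (htT : t ≤ T) :
    ∃ M, 0 < M ∧ ∀ s ∈ Icc t T, ‖β s‖ ≤ M := by
  obtain ⟨K, hK, hgr⟩ := exists_linear_growth D.pos (ht.trans htT) D.isCompact D.lip_f D.cont_f
  obtain ⟨R, hR⟩ := isCompact_Icc.exists_bound_of_continuousOn (h.continuousOn htT)
  have hR0 : 0 ≤ R := (norm_nonneg _).trans (hR t ⟨le_rfl, htT⟩)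
  refine ⟨K * (1 + R), by positivity, fun s hs => ?_⟩
  -- The trajectory is bounded and balls are convex, so linear growth bounds the whole hull.
  have hsub : convexHull ℝ (velocitySet f A s (x s)) ⊆ Metric.closedBall 0 (K * (1 + R)) := by
    refine convexHull_min ?_ (convex_closedBall _ _)
    rintro _ ⟨a, ha, rfl⟩
    rw [mem_closedBall_zero_iff, norm_neg]
    refine (hgr s ⟨ht.trans hs.1, hs.2⟩ (x s) a ha).trans ?_
    gcongr
    exact hR s hs
  simpa using hsub (h.control_mem s hs)

theorem intervalIntegrable_velocity (h : IsLaxAdmissible f A t T x₀ x β)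
    (D : ControlData T A f L Λ) (ht : 0 ≤ t) (htT : t ≤ T) :
    IntervalIntegrable β volume t T := by
  obtain ⟨M, -, hM⟩ := h.exists_norm_velocity_le D ht htT
  exact intervalIntegrable_of_norm_le htT h.aemeasurable_velocity.aestronglyMeasurable hM

theorem integral_velocity (h : IsLaxAdmissible f A t T x₀ x β)
    (D : ControlData T A f L Λ) (ht : 0 ≤ t) {σ τ : ℝ} (htσ : t ≤ σ) (hστ : σ ≤ τ) (hτT : τ ≤ T) :
    ∫ s in σ..τ, β s = x σ - x τ := by
  have htT := htσ.trans (hστ.trans hτT)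
  obtain ⟨M, -, hM⟩ := h.exists_norm_velocity_le D ht htT
  have hsub : uIcc σ τ ⊆ uIcc t T := by
    rw [uIcc_of_le hστ, uIcc_of_le htT]
    exact Icc_subset_Icc htσ hτT
  have h1 := (h.absCont.mono hsub).integral_eq_sub_of_ae_hasDerivAt
    ((h.intervalIntegrable_velocity D ht htT).neg.mono_set hsub) (M := M) (by
      filter_upwards [(ae_restrict_iff' measurableSet_Icc).1 h.dynamics] with s hs hs'
      exact hs (by simpa [uIcc_of_le htT] using hsub hs')) (fun s hs => by
      simpa using hM s (by simpa [uIcc_of_le htT] using hsub hs))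
  simp only [Pi.neg_apply, intervalIntegral.integral_neg] at h1
  rw [neg_eq_iff_eq_neg] at h1
  rw [h1]
  abel

theorem norm_sub_le (h : IsLaxAdmissible f A t T x₀ x β) (D : ControlData T A f L Λ) (ht : 0 ≤ t)
    {M : ℝ} (hM : ∀ s ∈ Icc t T, ‖β s‖ ≤ M) {σ τ : ℝ} (htσ : t ≤ σ) (hστ : σ ≤ τ) (hτT : τ ≤ T) :
    ‖x τ - x σ‖ ≤ M * (τ - σ) := by
  rw [norm_sub_rev, ← h.integral_velocity D ht htσ hστ hτT]
  have := intervalIntegral.norm_integral_le_of_norm_le_const (a := σ) (b := τ) (f := β) (C := M)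
    fun s hs => by
      rw [uIoc_of_le hστ] at hs
      exact hM s ⟨htσ.trans hs.1.le, hs.2.trans hτT⟩
  rwa [abs_of_nonneg (by linarith)] at this

theorem intervalIntegrable_conj (h : IsLaxAdmissible f A t T x₀ x β)
    (D : ControlData T A f L Λ) (ht : 0 ≤ t) (htT : t ≤ T) :
    IntervalIntegrable (fun s => (hamiltonianConj f L A s (x s) (β s)).toReal) volume t T := by
  have hsub : Icc t T ⊆ Icc 0 T := Icc_subset_Icc_left ht
  have hx := h.continuousOn htT
  obtain ⟨K, hK, hgr⟩ := exists_linear_growth D.pos (ht.trans htT) D.isCompact D.lip_L D.cont_L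
  obtain ⟨R, hR⟩ := isCompact_Icc.exists_bound_of_continuousOn hx
  refine intervalIntegrable_of_norm_le (M := K * (1 + R)) htT ?_ fun s hs => ?_
  · have hp : ∀ p : E n, AEMeasurable
        (fun s => ((⟪p, β s⟫ - hamiltonian f L A s (x s) p : ℝ) : EReal))
        (volume.restrict (Icc t T)) := by
      intro p
      have h1 : ContinuousOn (fun s => hamiltonian f L A s (x s) p) (Icc t T) :=
        ContinuousOn.comp (g := fun z : ℝ × E n => hamiltonian f L A z.1 z.2 p)
          (f := fun s => (s, x s)) (D.continuousOn_hamiltonian p) (continuousOn_id.prodMk hx)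
          fun s hs => ⟨hsub hs, mem_univ _⟩
      have h2 : AEMeasurable (fun s => ⟪p, β s⟫) (volume.restrict (Icc t T)) :=
        (innerSL ℝ p).continuous.measurable.comp_aemeasurable h.aemeasurable_velocity
      exact measurable_coe_real_ereal.comp_aemeasurable
        (h2.sub (h1.aemeasurable measurableSet_Icc))
    refine AEMeasurable.aestronglyMeasurable ?_
    refine measurable_ereal_toReal.comp_aemeasurable ?_
    refine (AEMeasurable.iSup fun k => hp (TopologicalSpace.denseSeq (E n) k)).congr ?_
    refine (ae_restrict_iff' measurableSet_Icc).2 (Filter.Eventually.of_forall fun s hs => ?_)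
    have hcont : Continuous fun p : E n => ⟪p, β s⟫ - hamiltonian f L A s (x s) p :=
      (continuous_id.inner continuous_const).sub (D.continuous_hamiltonian (hsub hs) (x s))
    exact (iSup_coe_eq_iSup_denseSeq hcont).symm
  · have hb : ∀ a ∈ A, |L s (x s) a| ≤ K * (1 + R) := fun a ha => by
      refine (hgr s (hsub hs) (x s) a ha).trans ?_
      gcongr
      exact hR s hs
    have h1 := D.hamiltonianConj_le (hsub hs) (h.control_mem s hs) fun a ha => (abs_le.1 (hb a ha)).2
    have h2 := D.le_hamiltonianConj (hsub hs) (b := β s) fun a ha => (abs_le.1 (hb a ha)).1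
    rw [← D.coe_toReal_hamiltonianConj (hsub hs) (h.control_mem s hs),
      EReal.coe_le_coe_iff] at h1 h2
    exact abs_le.2 ⟨h2, h1⟩

end IsLaxAdmissible

end Integrability

/-! ### Arcs of the controlled system -/

section Arcs

variable {n m : ℕ} {T Λ : ℝ} {A : Set (E m)} {f : ℝ → E n → E m → E n}
  {L : ℝ → E n → E m → ℝ}

/-- The trajectory `y` with control `α` leads from `z` at time `σ` to `w` at time `τ`, with running
cost `c` and speed at most `M`. -/
structure IsArc (f : ℝ → E n → E m → E n) (L : ℝ → E n → E m → ℝ) (A : Set (E m)) (M σ τ : ℝ)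
    (z w : E n) (c : ℝ) (y : ℝ → E n) (α : ℝ → E m) : Prop where
  measurable : Measurable α
  control_mem : ∀ s, α s ∈ A
  speed : ∀ s s', σ ≤ s → s ≤ s' → s' ≤ τ → ‖y s' - y s‖ ≤ M * (s' - s)
  start : y σ = z
  finish : y τ = w
  dynamics : ∀ᵐ s, s ∈ Ioo σ τ → HasDerivAt y (f s (y s) (α s)) s
  cost_eq : ∫ s in σ..τ, L s (y s) (α s) = c

/-- Some arc leads from `z` at time `σ` to `w` at time `τ`, with running cost `c` and speed at most
`M`. -/
def Reach (f : ℝ → E n → E m → E n) (L : ℝ → E n → E m → ℝ) (A : Set (E m)) (M σ τ : ℝ)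
    (z w : E n) (c : ℝ) : Prop :=
  ∃ y α, IsArc f L A M σ τ z w c y α

theorem IsArc.lipschitzOnWith {M σ τ c : ℝ} {z w : E n} {y : ℝ → E n} {α : ℝ → E m}
    (h : IsArc f L A M σ τ z w c y α) : LipschitzOnWith M.toNNReal y (Icc σ τ) := by
  have key : ∀ s ∈ Icc σ τ, ∀ r ∈ Icc σ τ, s ≤ r → ‖y r - y s‖ ≤ M.toNNReal * |r - s| := by
    intro s hs r hr hsr
    refine (h.speed s r hs.1 hsr hr.2).trans ?_
    rw [abs_of_nonneg (by linarith)]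
    have := Real.le_coe_toNNReal M
    have : 0 ≤ r - s := by linarith
    gcongr
  refine LipschitzOnWith.of_dist_le_mul fun s hs r hr => ?_
  rw [Real.dist_eq, dist_eq_norm]
  rcases le_total s r with hsr | hsr
  · rw [norm_sub_rev, abs_sub_comm]
    exact key s hs r hr hsr
  · exact key r hr s hs hsr

theorem IsArc.intervalIntegrable {M σ τ c : ℝ} {z w : E n} {y : ℝ → E n} {α : ℝ → E m}
    (h : IsArc f L A M σ τ z w c y α) (D : ControlData T A f L Λ) (hσ : 0 ≤ σ) (hστ : σ ≤ τ)
    (hτ : τ ≤ T) : IntervalIntegrable (fun s => L s (y s) (α s)) volume σ τ :=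
  D.intervalIntegrable_cost hσ hστ hτ h.lipschitzOnWith.continuousOn h.measurable.aemeasurable
    fun s _ => h.control_mem s

theorem Reach.norm_sub_le {M σ τ c : ℝ} {z w : E n} (h : Reach f L A M σ τ z w c) (hστ : σ ≤ τ) :
    ‖w - z‖ ≤ M * (τ - σ) := by
  obtain ⟨y, α, h⟩ := h
  have := h.speed σ τ le_rfl hστ le_rfl
  rwa [h.start, h.finish] at this

theorem Reach.refl (hA : A.Nonempty) (M σ : ℝ) (z : E n) : Reach f L A M σ σ z z 0 := by
  obtain ⟨a, ha⟩ := hA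
  refine ⟨fun _ => z, fun _ => a, measurable_const, fun _ => ha, fun s s' h1 h2 h3 => ?_, rfl, rfl,
    by simp, by simp⟩
  have : s' - s = 0 := by linarith
  simp [this]

theorem Reach.trans (D : ControlData T A f L Λ) {M σ τ ρ c c' : ℝ} {z w u : E n} (hσ : 0 ≤ σ)
    (hστ : σ ≤ τ) (hτρ : τ ≤ ρ) (hρ : ρ ≤ T) (h : Reach f L A M σ τ z w c)
    (h' : Reach f L A M τ ρ w u c') : Reach f L A M σ ρ z u (c + c') := by
  obtain ⟨y, α, h⟩ := h
  obtain ⟨y', α', h'⟩ := h'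
  have hint := h.intervalIntegrable D hσ hστ (hτρ.trans hρ)
  have hint' := h'.intervalIntegrable D (hσ.trans hστ) hτρ hρ
  set Y : ℝ → E n := fun s => if s ≤ τ then y s else y' s with hY
  set β : ℝ → E m := fun s => if s ≤ τ then α s else α' s with hβ
  have hY1 : ∀ s, s ≤ τ → Y s = y s := fun s hs => if_pos hs
  have hY2 : ∀ s, τ ≤ s → Y s = y' s := fun s hs => by
    rcases hs.eq_or_lt with rfl | hs
    · rw [hY1 _ le_rfl, h.finish, h'.start]
    · exact if_neg hs.not_ge
  have hβ1 : ∀ s, s ≤ τ → β s = α s := fun s hs => if_pos hs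
  have hβ2 : ∀ s, τ < s → β s = α' s := fun s hs => if_neg hs.not_ge
  have e1 : ∀ s ∈ uIoc σ τ, L s (y s) (α s) = L s (Y s) (β s) := fun s hs => by
    rw [uIoc_of_le hστ] at hs
    rw [hY1 s hs.2, hβ1 s hs.2]
  have e2 : ∀ s ∈ uIoc τ ρ, L s (y' s) (α' s) = L s (Y s) (β s) := fun s hs => by
    rw [uIoc_of_le hτρ] at hs
    rw [hY2 s hs.1.le, hβ2 s hs.1]
  refine ⟨Y, β, ⟨h.measurable.ite measurableSet_Iic h'.measurable, fun s => ?_,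
    fun s s' h1 h2 h3 => ?_, ?_, ?_, ?_, ?_⟩⟩
  · rw [hβ]
    dsimp only
    split_ifs
    exacts [h.control_mem s, h'.control_mem s]
  · rcases le_total s' τ with h4 | h4
    · rw [hY1 s' h4, hY1 s (h2.trans h4)]
      exact h.speed s s' h1 h2 h4
    · rcases le_total s τ with h5 | h5
      · have h6 := h.speed s τ h1 h5 le_rfl
        have h7 := h'.speed τ s' le_rfl h4 h3
        rw [hY2 s' h4, hY1 s h5]
        calc ‖y' s' - y s‖ = ‖(y' s' - y' τ) + (y τ - y s)‖ := by
              rw [h.finish, h'.start]; congr 1; abel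
          _ ≤ ‖y' s' - y' τ‖ + ‖y τ - y s‖ := norm_add_le _ _
          _ ≤ M * (s' - s) := by linarith
      · rw [hY2 s' h4, hY2 s h5]
        exact h'.speed s s' h5 h2 h3
  · rw [hY1 σ hστ, h.start]
  · rw [hY2 ρ hτρ, h'.finish]
  -- The glued curve may have a corner at the switching time `τ`, a null set.
  · filter_upwards [h.dynamics, h'.dynamics, compl_mem_ae_iff.2 (measure_singleton τ)]
      with s h1 h2 h3 hs
    rcases lt_or_gt_of_ne (h3 : s ≠ τ) with h4 | h4
    · rw [hY1 s h4.le, hβ1 s h4.le]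
      refine (h1 ⟨hs.1, h4⟩).congr_of_eventuallyEq ?_
      filter_upwards [Iio_mem_nhds h4] with r hr using hY1 r (le_of_lt hr)
    · rw [hY2 s h4.le, hβ2 s h4]
      refine (h2 ⟨h4, hs.2⟩).congr_of_eventuallyEq ?_
      filter_upwards [Ioi_mem_nhds h4] with r hr using hY2 r (le_of_lt hr)
  · rw [← intervalIntegral.integral_add_adjacent_intervals (hint.congr e1) (hint'.congr e2),
      ← h.cost_eq, ← h'.cost_eq]
    congr 1
    · exact (intervalIntegral.integral_congr_ae (Filter.Eventually.of_forall e1)).symm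
    · exact (intervalIntegral.integral_congr_ae (Filter.Eventually.of_forall e2)).symm

theorem Reach.exists_isAdmissible {M t c : ℝ} {z w : E n} (h : Reach f L A M t T z w c)
    (hA : IsCompact A) (htT : t ≤ T) (g : E n → ℝ) :
    ∃ x α, IsAdmissible f A t T z x α ∧ cost L g t T x α = c + g w := by
  obtain ⟨y, α, h⟩ := h
  refine ⟨y, α, ⟨?_, fun s _ => h.control_mem s, ?_, h.start, ?_⟩, ?_⟩
  · obtain ⟨R, hR⟩ := hA.isBounded.exists_norm_le
    exact MemLp.of_bound h.measurable.aestronglyMeasurable R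
      (Filter.Eventually.of_forall fun s => hR _ (h.control_mem s))
  · refine LipschitzOnWith.absolutelyContinuousOnInterval (K := M.toNNReal) ?_
    rw [uIcc_of_le htT]
    exact h.lipschitzOnWith
  · rw [Measure.restrict_congr_set Ioo_ae_eq_Icc.symm, ae_restrict_iff' measurableSet_Ioo]
    exact h.dynamics
  · rw [cost, h.cost_eq, h.finish]

namespace ControlData

/-- Existence of the trajectory with a constant control on a short time interval. -/
theorem exists_solution_const (D : ControlData T A f L Λ) {K : ℝ} (hK : 0 < K)
    (hgr : ∀ s ∈ Icc 0 T, ∀ x, ∀ a ∈ A, ‖f s x a‖ ≤ K * (1 + ‖x‖)) {σ τ : ℝ} (hσ : 0 ≤ σ)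
    (hστ : σ ≤ τ) (hτ : τ ≤ T) (hshort : 2 * K * (τ - σ) ≤ 1) (z : E n) {a : E m} (ha : a ∈ A) :
    ∃ y : ℝ → E n, y σ = z ∧
      (∀ s ∈ Icc σ τ, HasDerivWithinAt y (f s (y s) a) (Icc σ τ) s) ∧
      ∀ s ∈ Icc σ τ, 1 + ‖y s‖ ≤ (1 + ‖z‖) * Real.exp (K * (s - σ)) := by
  have hsub : Icc σ τ ⊆ Icc 0 T := Icc_subset_Icc hσ hτ
  have hΛ := D.pos
  -- On the ball of radius `1 + ‖z‖` about `z` the speed is at most `2 * K * (1 + ‖z‖)`, so `hshort`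
  -- keeps the solution inside. The length restriction does not depend on `z`.
  have hpl : IsPicardLindelof (fun s x => f s x a) (tmin := σ) (tmax := τ) ⟨σ, le_rfl, hστ⟩ z
      (.mk (1 + ‖z‖) (by positivity)) 0 (.mk (2 * K * (1 + ‖z‖)) (by positivity))
      (.mk Λ hΛ.le) := by
    refine ⟨fun s hs => ?_, fun x _ => ?_, fun s hs x hx => ?_, ?_⟩
    · refine LipschitzOnWith.of_dist_le_mul fun x _ x' _ => ?_
      rw [dist_eq_norm, dist_eq_norm]
      simpa using D.lip_f a ha s (hsub hs) s (hsub hs) x x'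
    · refine (LipschitzOnWith.of_dist_le_mul (K := .mk Λ hΛ.le) fun s hs s' hs' => ?_).continuousOn
      rw [dist_eq_norm, Real.dist_eq]
      simpa using D.lip_f a ha s (hsub hs) s' (hsub hs') x x
    · refine (hgr s (hsub hs) x a ha).trans ?_
      rw [NNReal.coe_mk, mul_comm 2 K, mul_assoc]
      rw [NNReal.coe_mk, mem_closedBall_iff_norm] at hx
      have : ‖x‖ ≤ ‖x - z‖ + ‖z‖ := by simpa using norm_add_le (x - z) z
      gcongr
      linarith
    · simp only [NNReal.coe_mk, sub_self, NNReal.coe_zero, sub_zero]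
      rw [max_eq_left (by linarith)]
      nlinarith [norm_nonneg z]
  obtain ⟨y, hy0, hy⟩ := hpl.exists_eq_forall_mem_Icc_hasDerivWithinAt₀
  refine ⟨y, hy0, hy, fun s hs => ?_⟩
  -- With `ε = K` the Gronwall bound becomes purely exponential for `1 + ‖y s‖`.
  have hgw := norm_le_gronwallBound_of_norm_deriv_right_le (δ := ‖z‖) (K := K) (ε := K)
    (fun s hs => (hy s hs).continuousWithinAt)
    (fun s hs => (hy s ⟨hs.1, hs.2.le⟩).mono_of_mem_nhdsWithin (Icc_mem_nhdsGE_of_mem hs))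
    (by rw [← hy0])
    (fun s hs => (hgr s (hsub ⟨hs.1, hs.2.le⟩) (y s) a ha).trans (by linarith)) s hs
  rw [gronwallBound_of_K_ne_0 hK.ne', div_self hK.ne'] at hgw
  linarith

/-- The bound `Γ * Real.exp (K * ·)` on `1 + ‖·‖` passes from the start to the end of the arc, so it
survives any number of switches and one speed bound `M` serves all arcs. The errors come from
comparison with the data frozen at `(p, ξ)`. -/
theorem exists_reach_const (D : ControlData T A f L Λ) {K : ℝ} (hK : 0 < K)
    (hgr : ∀ s ∈ Icc 0 T, ∀ x, ∀ a ∈ A, ‖f s x a‖ ≤ K * (1 + ‖x‖)) {Γ M : ℝ} (hΓ : 0 ≤ Γ)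
    (hM : K * (Γ * Real.exp (K * T)) ≤ M) {σ τ : ℝ} (hσ : 0 ≤ σ)
    (hστ : σ ≤ τ) (hτ : τ ≤ T) (hshort : 2 * K * (τ - σ) ≤ 1) {z : E n}
    (hz : 1 + ‖z‖ ≤ Γ * Real.exp (K * σ)) {a : E m} (ha : a ∈ A) :
    ∃ w c, Reach f L A M σ τ z w c ∧ 1 + ‖w‖ ≤ Γ * Real.exp (K * τ) ∧
      ∀ p ∈ Icc 0 T, ∀ ξ : E n, ∀ d, (∀ s ∈ Icc σ τ, |s - p| ≤ d) →
        ‖w - z - (τ - σ) • f p ξ a‖ ≤ (τ - σ) * (Λ * (d + ‖z - ξ‖ + M * (τ - σ))) ∧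
        ‖c - (τ - σ) * L p ξ a‖ ≤ (τ - σ) * (Λ * (d + ‖z - ξ‖ + M * (τ - σ))) := by
  have hsub : Icc σ τ ⊆ Icc 0 T := Icc_subset_Icc hσ hτ
  have hΛ := D.pos
  have hM0 : 0 ≤ M := le_trans (by positivity) hM
  obtain ⟨y, hy0, hy, hyn⟩ := D.exists_solution_const hK hgr hσ hστ hτ hshort z ha
  have hP : ∀ s ∈ Icc σ τ, 1 + ‖y s‖ ≤ Γ * Real.exp (K * s) := fun s hs => by
    refine (hyn s hs).trans ?_
    calc (1 + ‖z‖) * Real.exp (K * (s - σ))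
        ≤ Γ * Real.exp (K * σ) * Real.exp (K * (s - σ)) := by gcongr
      _ = Γ * Real.exp (K * s) := by rw [mul_assoc, ← Real.exp_add]; ring_nf
  have hspeed : ∀ s ∈ Icc σ τ, ‖f s (y s) a‖ ≤ M := fun s hs => by
    refine (hgr s (hsub hs) (y s) a ha).trans (le_trans ?_ hM)
    gcongr
    refine (hP s hs).trans ?_
    gcongr
    exact hs.2.trans hτ
  have harc : IsArc f L A M σ τ z (y τ) (∫ s in σ..τ, L s (y s) a) y fun _ => a := by
    refine ⟨measurable_const, fun _ => ha, fun s s' h1 h2 h3 => ?_, hy0, rfl, ?_, rfl⟩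
    · have hsub' : Icc s s' ⊆ Icc σ τ := Icc_subset_Icc h1 h3
      exact norm_image_sub_le_of_norm_deriv_le_segment' (fun r hr => (hy r (hsub' hr)).mono hsub')
        (fun r hr => hspeed r (hsub' ⟨hr.1, hr.2.le⟩)) s' ⟨h2, le_rfl⟩
    · exact Filter.Eventually.of_forall fun s hs =>
        (hy s ⟨hs.1.le, hs.2.le⟩).hasDerivAt (Icc_mem_nhds hs.1 hs.2)
  refine ⟨y τ, _, ⟨y, _, harc⟩, hP τ ⟨hστ, le_rfl⟩, fun p hp ξ d hd => ?_⟩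
  have hclose : ∀ s ∈ Icc σ τ, Λ * (|s - p| + ‖y s - ξ‖) ≤ Λ * (d + ‖z - ξ‖ + M * (τ - σ)) := by
    intro s hs
    have h1 := harc.speed σ s le_rfl hs.1 hs.2
    rw [hy0] at h1
    have h2 : ‖y s - ξ‖ ≤ ‖y s - z‖ + ‖z - ξ‖ := norm_sub_le_norm_sub_add_norm_sub _ _ _
    have h3 : M * (s - σ) ≤ M * (τ - σ) := by
      gcongr
      exact hs.2
    exact mul_le_mul_of_nonneg_left (by linarith [hd s hs]) hΛ.le
  constructor
  · have hd' : ∀ s ∈ Icc σ τ, HasDerivWithinAt (fun r => y r - r • f p ξ a)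
        (f s (y s) a - f p ξ a) (Icc σ τ) s := fun s hs => by
      simpa using (hy s hs).fun_sub ((hasDerivWithinAt_id s _).smul_const (f p ξ a))
    have := norm_image_sub_le_of_norm_deriv_le_segment' hd'
      (fun s hs => (D.lip_f a ha s (hsub ⟨hs.1, hs.2.le⟩) p hp (y s) ξ).trans
        (hclose s ⟨hs.1, hs.2.le⟩)) τ ⟨hστ, le_rfl⟩
    rw [mul_comm] at this
    refine le_of_eq_of_le ?_ this
    rw [hy0, sub_smul]
    congr 1
    abel
  · have hint := harc.intervalIntegrable D hσ hστ hτ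
    have h1 : (∫ s in σ..τ, L s (y s) a) - (τ - σ) * L p ξ a
        = ∫ s in σ..τ, (L s (y s) a - L p ξ a) := by
      rw [intervalIntegral.integral_sub hint intervalIntegrable_const,
        intervalIntegral.integral_const, smul_eq_mul]
    rw [h1]
    have := intervalIntegral.norm_integral_le_of_norm_le_const (a := σ) (b := τ)
      (f := fun s => L s (y s) a - L p ξ a) (C := Λ * (d + ‖z - ξ‖ + M * (τ - σ)))
      fun s hs => by
        rw [uIoc_of_le hστ] at hs
        exact (D.lip_L a ha s (hsub ⟨hs.1.le, hs.2⟩) p hp (y s) ξ).trans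
          (hclose s ⟨hs.1.le, hs.2⟩)
    rwa [abs_of_nonneg (by linarith), mul_comm] at this

end ControlData

end Arcs

/-! ### Convexification and steering -/

section Steering

variable {n m : ℕ} {T Λ : ℝ} {A : Set (E m)} {f : ℝ → E n → E m → E n}
  {L : ℝ → E n → E m → ℝ}

/-- The velocities and running costs available at `(s, x)`. -/
def augmentedVelocitySet (f : ℝ → E n → E m → E n) (L : ℝ → E n → E m → ℝ) (A : Set (E m))
    (s : ℝ) (x : E n) : Set (E n × ℝ) :=
  (fun a => (f s x a, L s x a)) '' A

namespace ControlData

/-- On a short time interval every convex combination of velocities and running costs is followed,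
up to a small error, by an arc with piecewise constant control. -/
theorem exists_reach_of_mem_convexHull (D : ControlData T A f L Λ) {K : ℝ} (hK : 0 < K)
    (hgr : ∀ s ∈ Icc 0 T, ∀ x, ∀ a ∈ A, ‖f s x a‖ ≤ K * (1 + ‖x‖)) {Γ M : ℝ} (hΓ : 0 ≤ Γ)
    (hM : K * (Γ * Real.exp (K * T)) ≤ M) {p h : ℝ} (hp : 0 ≤ p) (hh : 0 ≤ h) (hpT : p + h ≤ T)
    (hshort : 2 * K * h ≤ 1) {ξ : E n} {e δ : ℝ} (hδ : Λ * (h + e + M * h) ≤ δ)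
    {q : E n × ℝ} (hq : q ∈ convexHull ℝ (augmentedVelocitySet f L A p ξ)) {σ τ : ℝ} {z : E n}
    (hpσ : p ≤ σ) (hστ : σ ≤ τ) (hτ : τ ≤ p + h) (hz : 1 + ‖z‖ ≤ Γ * Real.exp (K * σ))
    (hzξ : ‖z - ξ‖ ≤ e + M * (σ - p)) :
    ∃ w c, Reach f L A M σ τ z w c ∧ 1 + ‖w‖ ≤ Γ * Real.exp (K * τ) ∧
      ‖w - z - (τ - σ) • q.1‖ ≤ (τ - σ) * δ ∧ ‖c - (τ - σ) * q.2‖ ≤ (τ - σ) * δ := by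
  have hΛ := D.pos
  -- Quantifying over all subintervals and starting points makes `S` convex, so convex combinations
  -- need not be written out.
  set S : Set (E n × ℝ) := {q | ∀ σ τ z, p ≤ σ → σ ≤ τ → τ ≤ p + h →
    1 + ‖z‖ ≤ Γ * Real.exp (K * σ) → ‖z - ξ‖ ≤ e + M * (σ - p) →
    ∃ w c, Reach f L A M σ τ z w c ∧ 1 + ‖w‖ ≤ Γ * Real.exp (K * τ) ∧
      ‖w - z - (τ - σ) • q.1‖ ≤ (τ - σ) * δ ∧ ‖c - (τ - σ) * q.2‖ ≤ (τ - σ) * δ} with hS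
  suffices hsub : convexHull ℝ (augmentedVelocitySet f L A p ξ) ⊆ S from
    hsub hq σ τ z hpσ hστ hτ hz hzξ
  refine convexHull_min ?_ ?_
  · rintro _ ⟨a, ha, rfl⟩ σ τ z hpσ hστ hτ hz hzξ
    have hlen : 2 * K * (τ - σ) ≤ 1 := by
      refine le_trans ?_ hshort
      gcongr
      linarith
    obtain ⟨w, c, hr, hw, H⟩ := D.exists_reach_const hK hgr hΓ hM (hp.trans hpσ) hστ
      (hτ.trans hpT) hlen hz ha
    obtain ⟨h1, h2⟩ := H p ⟨hp, by linarith⟩ ξ h fun s hs => by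
      rw [abs_of_nonneg (by linarith [hs.1])]
      linarith [hs.2]
    have h3 : (τ - σ) * (Λ * (h + ‖z - ξ‖ + M * (τ - σ))) ≤ (τ - σ) * δ := by
      have hM0 : 0 ≤ M := le_trans (by positivity) hM
      refine mul_le_mul_of_nonneg_left (le_trans ?_ hδ) (by linarith)
      refine mul_le_mul_of_nonneg_left ?_ hΛ.le
      have : M * (τ - p) ≤ M * h := mul_le_mul_of_nonneg_left (by linarith) hM0
      linarith
    exact ⟨w, c, hr, hw, h1.trans h3, h2.trans h3⟩
  · intro q hq q' hq' a b ha hb hab σ τ z hpσ hστ hτ hz hzξ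
    have hl : 0 ≤ τ - σ := by linarith
    -- Follow `q` for the fraction `a` of the time, then `q'` for the fraction `b`; both errors are
    -- proportional to length and add up to the same bound.
    obtain ⟨ρ, hρ⟩ : ∃ ρ, ρ = σ + a * (τ - σ) := ⟨_, rfl⟩
    have hρ1 : ρ - σ = a * (τ - σ) := by rw [hρ]; ring
    have hρ2 : τ - ρ = b * (τ - σ) := by rw [hρ, eq_sub_of_add_eq' hab]; ring
    have hσρ : σ ≤ ρ := by nlinarith
    have hρτ : ρ ≤ τ := by nlinarith
    obtain ⟨w, c, hr, hw, h1, h2⟩ := hq σ ρ z hpσ hσρ (hρτ.trans hτ) hz hzξ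
    have hwξ : ‖w - ξ‖ ≤ e + M * (ρ - p) := by
      have := hr.norm_sub_le hσρ
      have : ‖w - ξ‖ ≤ ‖w - z‖ + ‖z - ξ‖ := norm_sub_le_norm_sub_add_norm_sub _ _ _
      linarith
    obtain ⟨w', c', hr', hw', h1', h2'⟩ := hq' ρ τ w (hpσ.trans hσρ) hρτ hτ hw hwξ
    refine ⟨w', c + c', hr.trans D (hp.trans hpσ) hσρ hρτ (hτ.trans hpT) hr', hw', ?_, ?_⟩
    · have : w' - z - (τ - σ) • (a • q + b • q').1
          = (w' - w - (τ - ρ) • q'.1) + (w - z - (ρ - σ) • q.1) := by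
        rw [hρ1, hρ2, Prod.fst_add, Prod.smul_fst, Prod.smul_fst, smul_add, smul_smul, smul_smul,
          mul_comm _ a, mul_comm _ b]
        abel
      rw [this]
      refine (norm_add_le _ _).trans ?_
      linarith
    · have : c + c' - (τ - σ) * (a • q + b • q').2
          = (c' - (τ - ρ) * q'.2) + (c - (ρ - σ) * q.2) := by
        rw [hρ1, hρ2, Prod.snd_add, Prod.smul_snd, Prod.smul_snd, smul_eq_mul, smul_eq_mul]
        ring
      rw [this]
      refine (norm_add_le _ _).trans ?_
      linarith

end ControlData

/-- Hahn–Banach: since `S` is closed under raising the cost, a separating functional has nonnegative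
cost coefficient, so only such functionals need testing. -/
theorem mem_closure_of_forall_exists_le {S : Set (E n × ℝ)} (hS : Convex ℝ S) (hne : S.Nonempty)
    (hup : ∀ w ∈ S, ∀ k, 0 ≤ k → (w.1, w.2 + k) ∈ S) {v : E n × ℝ}
    (hv : ∀ q : E n, ∀ μ, 0 ≤ μ → ∃ w ∈ S, ⟪q, w.1⟫ + μ * w.2 ≤ ⟪q, v.1⟫ + μ * v.2) :
    v ∈ closure S := by
  by_contra hnot
  obtain ⟨φ, u, h1, h2⟩ := geometric_hahn_banach_point_closed hS.closure isClosed_closure hnot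
  set q : E n := (InnerProductSpace.toDual ℝ (E n)).symm (φ.comp (ContinuousLinearMap.inl ℝ _ _))
    with hq
  set μ : ℝ := φ (0, 1) with hμ
  have hφ : ∀ w, φ w = ⟪q, w.1⟫ + μ * w.2 := fun w => by
    rw [hq, InnerProductSpace.toDual_symm_apply, ContinuousLinearMap.comp_apply,
      ContinuousLinearMap.inl_apply, hμ, mul_comm, ← smul_eq_mul, ← map_smul, ← map_add]
    simp
  have hμ0 : 0 ≤ μ := by
    by_contra hneg
    push Not at hneg
    obtain ⟨w, hw⟩ := hne
    have h3 := h2 w (subset_closure hw)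
    -- If `μ < 0`, raising the cost by this amount brings `φ` down exactly to `u`, against strict
    -- separation.
    have h4 := h2 _ (subset_closure (hup w hw ((φ w - u) / (-μ)) (div_nonneg (by linarith)
      (by linarith))))
    rw [hφ] at h4
    simp only at h4
    have h5 : μ * (w.2 + (φ w - u) / (-μ)) = μ * w.2 - (φ w - u) := by
      have := hneg.ne
      field_simp
      ring
    rw [h5, hφ w] at h4
    linarith
  obtain ⟨w, hw, h3⟩ := hv q μ hμ0
  have h4 := h2 w (subset_closure hw)
  rw [hφ] at h1 h4
  linarith

/-- Points that lie, up to `δ` in the velocity and in the cost, above the convex hull of the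
available velocities and running costs. -/
def relaxedVelocitySet (f : ℝ → E n → E m → E n) (L : ℝ → E n → E m → ℝ) (A : Set (E m))
    (δ s : ℝ) (x : E n) : Set (E n × ℝ) :=
  {w | ∃ u ∈ convexHull ℝ (augmentedVelocitySet f L A s x), ‖w.1 - u.1‖ ≤ δ ∧ u.2 ≤ w.2 + δ}

theorem convex_relaxedVelocitySet (δ s : ℝ) (x : E n) :
    Convex ℝ (relaxedVelocitySet f L A δ s x) := by
  rintro w ⟨u, hu, h1, h2⟩ w' ⟨u', hu', h1', h2'⟩ a b ha hb hab
  refine ⟨a • u + b • u', convex_convexHull ℝ _ hu hu' ha hb hab, ?_, ?_⟩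
  · have : (a • w + b • w').1 - (a • u + b • u').1 = a • (w.1 - u.1) + b • (w'.1 - u'.1) := by
      simp only [Prod.fst_add, Prod.smul_fst, smul_sub]
      abel
    rw [this]
    calc ‖a • (w.1 - u.1) + b • (w'.1 - u'.1)‖ ≤ a * ‖w.1 - u.1‖ + b * ‖w'.1 - u'.1‖ := by
          refine (norm_add_le _ _).trans ?_
          rw [norm_smul, norm_smul, Real.norm_of_nonneg ha, Real.norm_of_nonneg hb]
      _ ≤ a * δ + b * δ := by gcongr
      _ = δ := by rw [← add_mul, hab, one_mul]
  · simp only [Prod.snd_add, Prod.smul_snd, smul_eq_mul]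
    have h3 := mul_le_mul_of_nonneg_left h2 ha
    have h4 := mul_le_mul_of_nonneg_left h2' hb
    have h5 : a * δ + b * δ = δ := by rw [← add_mul, hab, one_mul]
    linarith

namespace ControlData

/-- The tolerance `δ` absorbs the change of base point from `(s, x)` to `(p, ξ)`, so a single convex
set serves a whole time step. -/
theorem mem_closure_relaxedVelocitySet (D : ControlData T A f L Λ) {s p δ : ℝ} (hs : s ∈ Icc 0 T)
    (hp : p ∈ Icc 0 T) {x ξ b : E n} (hδ : Λ * (|s - p| + ‖x - ξ‖) ≤ δ)
    (hb : b ∈ convexHull ℝ (velocitySet f A s x)) :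
    (-b, (hamiltonianConj f L A s x b).toReal) ∈ closure (relaxedVelocitySet f L A δ p ξ) := by
  have hmem : ∀ a ∈ A, (f s x a, L s x a) ∈ relaxedVelocitySet f L A δ p ξ := fun a ha => by
    refine ⟨(f p ξ a, L p ξ a), subset_convexHull ℝ _ ⟨a, ha, rfl⟩,
      (D.lip_f a ha s hs p hp x ξ).trans hδ, ?_⟩
    have := (abs_le.1 ((D.lip_L a ha s hs p hp x ξ).trans hδ)).1
    simp only
    linarith
  refine mem_closure_of_forall_exists_le (convex_relaxedVelocitySet δ p ξ) ?_ ?_ ?_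
  · obtain ⟨a, ha⟩ := D.nonempty
    exact ⟨_, hmem a ha⟩
  · rintro w ⟨u, hu, h1, h2⟩ k hk
    exact ⟨u, hu, h1, by simp only; linarith⟩
  · intro q μ hμ
    obtain ⟨a, ha, h⟩ := D.exists_inner_add_mul_le hs hb q hμ
    exact ⟨_, hmem a ha, h⟩

end ControlData

/-- The mean of a function with values in a closed convex set stays in the set, and the mean of `-β`
is the difference quotient of `x`. -/
theorem IsLaxAdmissible.exists_mem_convexHull_average {t x₀ x β} (hx : IsLaxAdmissible f A t T x₀ x β)
    (D : ControlData T A f L Λ) (ht : 0 ≤ t) {M : ℝ} (hM0 : 0 ≤ M)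
    (hM : ∀ s ∈ Icc t T, ‖β s‖ ≤ M) {p h δ : ℝ} (hp : t ≤ p) (hh : 0 ≤ h) (hpT : p + h ≤ T)
    (hδ : Λ * (h + M * h) ≤ δ) :
    ∃ q ∈ convexHull ℝ (augmentedVelocitySet f L A p (x p)),
      ‖x (p + h) - x p - h • q.1‖ ≤ h * (2 * δ) ∧
      h * q.2 ≤ (∫ s in p..(p + h), (hamiltonianConj f L A s (x s) (β s)).toReal)
        + h * (2 * δ) := by
  have hΛ := D.pos
  rcases hh.eq_or_lt with rfl | hh
  · obtain ⟨a, ha⟩ := D.nonempty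
    exact ⟨_, subset_convexHull ℝ _ ⟨a, ha, rfl⟩, by simp, by simp⟩
  have hδ0 : 0 < δ := lt_of_lt_of_le (by positivity) hδ
  have htT : t ≤ T := by linarith
  have hph : p ≤ p + h := by linarith
  have hsub : uIcc p (p + h) ⊆ uIcc t T := by
    rw [uIcc_of_le hph, uIcc_of_le htT]
    exact Icc_subset_Icc hp hpT
  set H : ℝ → ℝ := fun s => (hamiltonianConj f L A s (x s) (β s)).toReal with hH
  have hβi := (hx.intervalIntegrable_velocity D ht htT).mono_set hsub
  have hHi : IntervalIntegrable H volume p (p + h) :=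
    (hx.intervalIntegrable_conj D ht htT).mono_set hsub
  rw [intervalIntegrable_iff_integrableOn_Ioc_of_le hph] at hβi hHi
  have hmem : ∀ s ∈ Ioc p (p + h), (-β s, H s) ∈ closure (relaxedVelocitySet f L A δ p (x p)) := by
    intro s hs
    have hsT : s ≤ T := hs.2.trans hpT
    refine D.mem_closure_relaxedVelocitySet ⟨by linarith [hs.1], hsT⟩
      ⟨by linarith, by linarith⟩ (le_trans ?_ hδ) (hx.control_mem s ⟨by linarith [hs.1], hsT⟩)
    have h1 := hx.norm_sub_le D ht hM hp hs.1.le hsT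
    have h2 : M * (s - p) ≤ M * h := mul_le_mul_of_nonneg_left (by linarith [hs.2]) hM0
    rw [abs_of_nonneg (by linarith [hs.1])]
    exact mul_le_mul_of_nonneg_left (by linarith [hs.2]) hΛ.le
  have havg := (convex_relaxedVelocitySet (f := f) (L := L) (A := A) δ p (x p)).closure.set_average_mem
    isClosed_closure (μ := volume) (t := Ioc p (p + h)) (f := fun s => (-β s, H s))
    (by simpa using hh) (by simp)
    ((ae_restrict_iff' measurableSet_Ioc).2 (Filter.Eventually.of_forall hmem))
    (hβi.neg.prodMk hHi)
  rw [setAverage_eq, Real.volume_real_Ioc_of_le hph, add_sub_cancel_left,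
    integral_pair (f := fun s => -β s) hβi.neg hHi, ← intervalIntegral.integral_of_le hph,
    ← intervalIntegral.integral_of_le hph] at havg
  rw [intervalIntegral.integral_neg] at havg
  rw [hx.integral_velocity D ht hp hph hpT, neg_sub] at havg
  -- One `δ` is spent on leaving the closure, the other on passing from the relaxed set to the hull.
  obtain ⟨w, ⟨u, hu, h1, h2⟩, hw⟩ := Metric.mem_closure_iff.1 havg δ hδ0
  rw [Prod.dist_eq, max_lt_iff, dist_eq_norm, Real.dist_eq] at hw
  simp only [Prod.smul_mk, smul_eq_mul] at hw
  obtain ⟨h3, h4⟩ := hw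
  refine ⟨u, hu, ?_, ?_⟩
  · have : x (p + h) - x p - h • u.1 = h • ((h⁻¹ • (x (p + h) - x p) - w.1) + (w.1 - u.1)) := by
      rw [sub_add_sub_cancel, smul_sub, smul_smul, mul_inv_cancel₀ hh.ne', one_smul]
    rw [this, norm_smul, Real.norm_of_nonneg hh.le]
    refine mul_le_mul_of_nonneg_left ((norm_add_le _ _).trans ?_) hh.le
    linarith
  · have h5 := (abs_lt.1 h4).1
    have h6 : u.2 ≤ h⁻¹ * (∫ s in p..(p + h), H s) + 2 * δ := by linarith
    have h7 := mul_le_mul_of_nonneg_left h6 hh.le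
    rwa [mul_add, ← mul_assoc, mul_inv_cancel₀ hh.ne', one_mul] at h7

end Steering

/-! ### Approximating Lax trajectories by arcs -/

section Approximation

variable {n m : ℕ} {T Λ : ℝ} {A : Set (E m)} {f : ℝ → E n → E m → E n}
  {L : ℝ → E n → E m → ℝ} {t : ℝ} {x₀ : E n} {x β : ℝ → E n}

theorem le_mul_exp_sub {c K s t : ℝ} (hc : 0 ≤ c) (hK : 0 ≤ K) (hts : t ≤ s) :
    c ≤ c * Real.exp (K * (s - t)) :=
  le_mul_of_one_le_right hc (Real.one_le_exp (mul_nonneg hK (by linarith)))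

theorem ControlData.exists_reach (D : ControlData T A f L Λ) {K : ℝ} (hK : 0 < K)
    (hgr : ∀ s ∈ Icc 0 T, ∀ x, ∀ a ∈ A, ‖f s x a‖ ≤ K * (1 + ‖x‖)) {Γ M : ℝ} (hΓ : 0 ≤ Γ)
    (hM : K * (Γ * Real.exp (K * T)) ≤ M) (ht : 0 ≤ t) {h : ℝ} (hh : 0 ≤ h)
    (hshort : 2 * K * h ≤ 1) (hz : 1 + ‖x₀‖ ≤ Γ * Real.exp (K * t)) (k : ℕ) :
    t + k * h ≤ T → ∃ w c, Reach f L A M t (t + k * h) x₀ w c ∧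
      1 + ‖w‖ ≤ Γ * Real.exp (K * (t + k * h)) := by
  induction k with
  | zero => exact fun _ => ⟨x₀, 0, by simpa using Reach.refl D.nonempty M t x₀, by simpa using hz⟩
  | succ k ih =>
    intro hk
    obtain ⟨p, hp⟩ : ∃ p, p = t + k * h := ⟨_, rfl⟩
    have e1 : t + (k + 1 : ℕ) * h = p + h := by rw [hp]; push_cast; ring
    have htp : t ≤ p := by rw [hp]; linarith [mul_nonneg (Nat.cast_nonneg (α := ℝ) k) hh]
    rw [← hp] at ih
    rw [e1] at hk ⊢
    obtain ⟨w, c, h1, h2⟩ := ih (by linarith)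
    obtain ⟨a, ha⟩ := D.nonempty
    obtain ⟨w', c', h1', h2', -⟩ := D.exists_reach_const hK hgr hΓ hM (ht.trans htp)
      (by linarith : p ≤ p + h) hk (by rwa [add_sub_cancel_left]) h2 ha
    exact ⟨w', c + c', h1.trans D ht htp (by linarith) hk h1', h2'⟩

/-- Over one short time interval, an arc stays close to a trajectory of the Lax problem at no
higher cost, up to small errors. -/
theorem IsLaxAdmissible.exists_reach_step (hx : IsLaxAdmissible f A t T x₀ x β)
    (D : ControlData T A f L Λ) {K : ℝ} (hK : 0 < K)
    (hgr : ∀ s ∈ Icc 0 T, ∀ x, ∀ a ∈ A, ‖f s x a‖ ≤ K * (1 + ‖x‖)) {Γ M : ℝ} (hΓ : 0 ≤ Γ)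
    (hM : K * (Γ * Real.exp (K * T)) ≤ M) (hβ : ∀ s ∈ Icc t T, ‖β s‖ ≤ M) (ht : 0 ≤ t) {p h e : ℝ}
    (hp : t ≤ p) (hh : 0 ≤ h) (hpT : p + h ≤ T) (hshort : 2 * K * h ≤ 1) {z : E n}
    (hz : 1 + ‖z‖ ≤ Γ * Real.exp (K * p)) (hze : ‖z - x p‖ ≤ e) :
    ∃ w c, Reach f L A M p (p + h) z w c ∧ 1 + ‖w‖ ≤ Γ * Real.exp (K * (p + h)) ∧
      ‖w - x (p + h)‖ ≤ e + h * (3 * (Λ * (h + e + M * h))) ∧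
      c ≤ (∫ s in p..(p + h), (hamiltonianConj f L A s (x s) (β s)).toReal)
        + h * (3 * (Λ * (h + e + M * h))) := by
  have hM0 : 0 ≤ M := le_trans (by positivity) hM
  have he : 0 ≤ e := (norm_nonneg _).trans hze
  -- The hull is based at `x p`, not at `z`. With `δ = Λ * (h + e + M * h)`, averaging costs `2 * δ`
  -- and steering `δ`, whence the factor `3`.
  obtain ⟨q, hq, h1, h2⟩ := hx.exists_mem_convexHull_average D ht hM0 hβ hp hh hpT
    (δ := Λ * (h + e + M * h)) (mul_le_mul_of_nonneg_left (by linarith) D.pos.le)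
  obtain ⟨w, c, h3, h4, h5, h6⟩ := D.exists_reach_of_mem_convexHull hK hgr hΓ hM (ht.trans hp) hh
    hpT hshort le_rfl hq le_rfl (by linarith : p ≤ p + h) le_rfl hz (by simpa using hze)
  rw [add_sub_cancel_left] at h5 h6
  refine ⟨w, c, h3, h4, ?_, ?_⟩
  · have : w - x (p + h) = (w - z - h • q.1) + (z - x p) - (x (p + h) - x p - h • q.1) := by abel
    rw [this]
    refine (_root_.norm_sub_le _ _).trans ?_
    have := norm_add_le (w - z - h • q.1) (z - x p)
    linarith
  · have := (abs_le.1 h6).2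
    linarith

/-- Discrete Gronwall: adding `(1 + M) * h` to the distance makes the one-step recursion
multiplicative, with factor `1 + 3 * Λ * h ≤ Real.exp (3 * Λ * h)`. -/
theorem IsLaxAdmissible.exists_reach_grid (hx : IsLaxAdmissible f A t T x₀ x β)
    (D : ControlData T A f L Λ) {K : ℝ} (hK : 0 < K)
    (hgr : ∀ s ∈ Icc 0 T, ∀ x, ∀ a ∈ A, ‖f s x a‖ ≤ K * (1 + ‖x‖)) {Γ M : ℝ} (hΓ : 0 ≤ Γ)
    (hM : K * (Γ * Real.exp (K * T)) ≤ M) (hβ : ∀ s ∈ Icc t T, ‖β s‖ ≤ M) (ht : 0 ≤ t) {h : ℝ}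
    (hh : 0 ≤ h) (hshort : 2 * K * h ≤ 1) (hz : 1 + ‖x₀‖ ≤ Γ * Real.exp (K * t)) (k : ℕ) :
    t + k * h ≤ T → ∃ w c, Reach f L A M t (t + k * h) x₀ w c ∧
      1 + ‖w‖ ≤ Γ * Real.exp (K * (t + k * h)) ∧
      ‖w - x (t + k * h)‖ + (1 + M) * h ≤ (1 + M) * h * Real.exp (3 * Λ * (k * h)) ∧
      c ≤ (∫ s in t..(t + k * h), (hamiltonianConj f L A s (x s) (β s)).toReal)
        + k * h * (3 * Λ * ((1 + M) * h * Real.exp (3 * Λ * T))) := by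
  have hM0 : 0 ≤ M := le_trans (by positivity) hM
  have hΛ := D.pos
  induction k with
  | zero =>
    refine fun _ => ⟨x₀, 0, by simpa using Reach.refl D.nonempty M t x₀, by simpa using hz, ?_, ?_⟩
    · simp [hx.initial]
    · simp
  | succ k ih =>
    intro hk
    obtain ⟨ℓ, hℓ⟩ : ∃ ℓ, ℓ = k * h := ⟨_, rfl⟩
    obtain ⟨p, hp⟩ : ∃ p, p = t + ℓ := ⟨_, rfl⟩
    have hℓ0 : 0 ≤ ℓ := by rw [hℓ]; positivity
    have e0 : ((k + 1 : ℕ) : ℝ) * h = ℓ + h := by rw [hℓ]; push_cast; ring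
    have htp : t ≤ p := by linarith
    rw [← hℓ, ← hp] at ih
    rw [e0, ← add_assoc, ← hp] at hk ⊢
    obtain ⟨w, c, h1, h2, h3, h4⟩ := ih (by linarith)
    obtain ⟨w', c', h1', h2', h3', h4'⟩ := hx.exists_reach_step D hK hgr hΓ hM hβ ht htp hh hk hshort
      h2 le_rfl
    set e := ‖w - x p‖
    have h5 : h + e + M * h = e + (1 + M) * h := by ring
    rw [h5] at h3' h4'
    refine ⟨w', c + c', h1.trans D ht htp (by linarith) hk h1', h2', ?_, ?_⟩
    · have h6 : (1 + h * (3 * Λ)) ≤ Real.exp (3 * Λ * h) := by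
        have := Real.add_one_le_exp (3 * Λ * h)
        linarith
      calc ‖w' - x (p + h)‖ + (1 + M) * h ≤ (e + (1 + M) * h) * (1 + h * (3 * Λ)) := by linarith
        _ ≤ (1 + M) * h * Real.exp (3 * Λ * ℓ) * Real.exp (3 * Λ * h) := by gcongr
        _ = (1 + M) * h * Real.exp (3 * Λ * (ℓ + h)) := by
          rw [mul_assoc _ (Real.exp _), ← Real.exp_add, ← mul_add]
    · have hadj : (∫ s in t..p, (hamiltonianConj f L A s (x s) (β s)).toReal)
          + ∫ s in p..(p + h), (hamiltonianConj f L A s (x s) (β s)).toReal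
          = ∫ s in t..(p + h), (hamiltonianConj f L A s (x s) (β s)).toReal := by
        have hint := hx.intervalIntegrable_conj D ht (by linarith)
        refine intervalIntegral.integral_add_adjacent_intervals (hint.mono_set ?_)
          (hint.mono_set ?_)
        · rw [uIcc_of_le htp, uIcc_of_le (by linarith)]
          exact Icc_subset_Icc le_rfl (by linarith)
        · rw [uIcc_of_le (by linarith), uIcc_of_le (by linarith)]
          exact Icc_subset_Icc htp hk
      have h7 : h * (3 * (Λ * (e + (1 + M) * h)))
          ≤ h * (3 * Λ * ((1 + M) * h * Real.exp (3 * Λ * T))) := by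
        rw [← mul_assoc 3 Λ]
        gcongr
        refine h3.trans ?_
        gcongr
        linarith
      linarith

theorem exists_nat_forall_mul_div_le (K ℓ : ℝ) :
    ∃ N₀ : ℕ, ∀ N : ℕ, N₀ ≤ N → 0 < N ∧ 2 * K * (ℓ / N) ≤ 1 := by
  have h : Filter.Tendsto (fun N : ℕ => 2 * K * (ℓ / N)) Filter.atTop (nhds (2 * K * 0)) :=
    (tendsto_const_div_atTop_nhds_zero_nat ℓ).const_mul _
  rw [mul_zero] at h
  obtain ⟨N₀, hN₀⟩ := Filter.eventually_atTop.1
    ((h.eventually_le_const one_pos).and (Filter.eventually_gt_atTop 0))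
  exact ⟨N₀, fun N hN => (hN₀ N hN).symm⟩

theorem ControlData.exists_isAdmissible (D : ControlData T A f L Λ) (ht : 0 ≤ t) (htT : t ≤ T)
    (x₀ : E n) : ∃ x α, IsAdmissible f A t T x₀ x α := by
  obtain ⟨K, hK, hgr⟩ := exists_linear_growth D.pos (ht.trans htT) D.isCompact D.lip_f D.cont_f
  obtain ⟨N, hN⟩ := exists_nat_forall_mul_div_le K (T - t)
  obtain ⟨hN0, hN1⟩ := hN N le_rfl
  have hNT : t + N * ((T - t) / N) = T := by
    field_simp
    ring
  obtain ⟨w, c, h, -⟩ := D.exists_reach hK hgr (Γ := 1 + ‖x₀‖) (by positivity) le_rfl ht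
    (div_nonneg (by linarith) (Nat.cast_nonneg N)) hN1
    (by simpa using le_mul_exp_sub (t := 0) (by positivity : 0 ≤ 1 + ‖x₀‖) hK.le ht) N hNT.le
  rw [hNT] at h
  obtain ⟨x, α, hx, -⟩ := h.exists_isAdmissible D.isCompact htT fun _ => 0
  exact ⟨x, α, hx⟩

theorem IsLaxAdmissible.value_le_laxCost (hx : IsLaxAdmissible f A t T x₀ x β)
    (D : ControlData T A f L Λ) (ht : 0 ≤ t) (htT : t ≤ T) {g : E n → ℝ} {Lg : ℝ}
    (hg : ∀ x₁ x₂ : E n, |g x₁ - g x₂| ≤ Lg * ‖x₁ - x₂‖) :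
    value f L g A T t x₀ ≤ ((laxCost f L g A t T x β : ℝ) : EReal) := by
  obtain ⟨K, hK, hgr⟩ := exists_linear_growth D.pos (ht.trans htT) D.isCompact D.lip_f D.cont_f
  obtain ⟨N₀, hN₀⟩ := exists_nat_forall_mul_div_le K (T - t)
  obtain ⟨M', hM', hβ⟩ := hx.exists_norm_velocity_le D ht htT
  -- `M` bounds the speed of both the Lax trajectory and the constructed arcs, independently of the
  -- number of steps.
  set M := max M' (K * ((1 + ‖x₀‖) * Real.exp (K * T))) with hM
  have hM0 : 0 < M := lt_max_of_lt_left hM'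
  set B := (1 + M) * Real.exp (3 * Λ * T) with hB
  have hΛ := D.pos
  have hlim : Filter.Tendsto (fun N : ℕ => ((laxCost f L g A t T x β
      + ((T - t) * (3 * Λ * B) + |Lg| * B) * ((T - t) / N) : ℝ) : EReal)) Filter.atTop
      (nhds ((laxCost f L g A t T x β : ℝ) : EReal)) := by
    refine (continuous_coe_real_ereal.tendsto _).comp ?_
    simpa using ((tendsto_const_div_atTop_nhds_zero_nat (T - t)).const_mul
      ((T - t) * (3 * Λ * B) + |Lg| * B)).const_add (laxCost f L g A t T x β)
  refine ge_of_tendsto hlim (Filter.eventually_atTop.2 ⟨N₀, fun N hN => ?_⟩)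
  obtain ⟨hN0, hN1⟩ := hN₀ N hN
  obtain ⟨h, hh⟩ : ∃ h, h = (T - t) / N := ⟨_, rfl⟩
  have hh0 : 0 ≤ h := by
    rw [hh]
    exact div_nonneg (by linarith) (Nat.cast_nonneg N)
  have hNh : N * h = T - t := by
    rw [hh]
    field_simp
  have hNT : t + N * h = T := by linarith
  rw [← hh] at hN1 ⊢
  obtain ⟨w, c, h1, -, h2, h3⟩ := hx.exists_reach_grid D hK hgr (Γ := 1 + ‖x₀‖) (by positivity)
    (le_max_right _ _) (fun s hs => (hβ s hs).trans (le_max_left _ _)) ht hh0 hN1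
    (by simpa using le_mul_exp_sub (t := 0) (by positivity : 0 ≤ 1 + ‖x₀‖) hK.le ht) N hNT.le
  rw [← hM, hNT] at h1
  rw [← hM, hNT, hNh] at h2 h3
  obtain ⟨y, α, hy, hcost⟩ := h1.exists_isAdmissible D.isCompact htT g
  refine (iInf_le_of_le y (iInf_le_of_le α (iInf_le_of_le hy ?_)))
  rw [EReal.coe_le_coe_iff, hcost, laxCost]
  have h4 : ‖w - x T‖ ≤ B * h := by
    have h5 : Real.exp (3 * Λ * (T - t)) ≤ Real.exp (3 * Λ * T) := by
      gcongr
      linarith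
    have h6 : (1 + M) * h * Real.exp (3 * Λ * (T - t)) ≤ (1 + M) * h * Real.exp (3 * Λ * T) :=
      mul_le_mul_of_nonneg_left h5 (by positivity)
    have h7 : (1 + M) * h * Real.exp (3 * Λ * T) = B * h := by rw [hB]; ring
    have h8 : 0 ≤ (1 + M) * h := by positivity
    linarith
  have h5 : g w - g (x T) ≤ |Lg| * (B * h) := by
    refine ((le_abs_self _).trans (hg w (x T))).trans ?_
    refine (mul_le_mul_of_nonneg_right (le_abs_self Lg) (norm_nonneg _)).trans ?_
    exact mul_le_mul_of_nonneg_left h4 (abs_nonneg _)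
  have h6 : (T - t) * (3 * Λ * ((1 + M) * h * Real.exp (3 * Λ * T)))
      = (T - t) * (3 * Λ * B) * h := by rw [hB]; ring
  linarith

end Approximation

/-! ### The direct inequality and the lower bound -/

section Comparison

variable {n m : ℕ} {T Λ : ℝ} {A : Set (E m)} {f : ℝ → E n → E m → E n}
  {L : ℝ → E n → E m → ℝ} {t : ℝ} {x₀ : E n} {x : ℝ → E n} {α : ℝ → E m}

theorem IsAdmissible.intervalIntegrable_cost (h : IsAdmissible f A t T x₀ x α)
    (D : ControlData T A f L Λ) (ht : 0 ≤ t) (htT : t ≤ T) :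
    IntervalIntegrable (fun s => L s (x s) (α s)) volume t T :=
  D.intervalIntegrable_cost ht htT le_rfl (by simpa [uIcc_of_le htT] using h.absCont.continuousOn)
    h.control_bounded.aestronglyMeasurable.aemeasurable h.control_mem

theorem IsAdmissible.isLaxAdmissible (h : IsAdmissible f A t T x₀ x α) :
    IsLaxAdmissible f A t T x₀ x fun s => -f s (x s) (α s) :=
  ⟨h.absCont, h.initial, by simpa using h.dynamics,
    fun s hs => subset_convexHull ℝ _ ⟨_, h.control_mem s hs, rfl⟩⟩

theorem IsAdmissible.laxCost_le_cost (h : IsAdmissible f A t T x₀ x α)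
    (D : ControlData T A f L Λ) (ht : 0 ≤ t) (htT : t ≤ T) (g : E n → ℝ) :
    laxCost f L g A t T x (fun s => -f s (x s) (α s)) ≤ cost L g t T x α := by
  refine add_le_add ?_ le_rfl
  refine intervalIntegral.integral_mono_on htT (h.isLaxAdmissible.intervalIntegrable_conj D ht htT)
    (h.intervalIntegrable_cost D ht htT) fun s hs => ?_
  have hs' : s ∈ Icc 0 T := ⟨ht.trans hs.1, hs.2⟩
  have hα := h.control_mem s hs
  rw [← EReal.coe_le_coe_iff,
    D.coe_toReal_hamiltonianConj hs' (subset_convexHull ℝ _ ⟨_, hα, rfl⟩)]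
  exact D.hamiltonianConj_neg_le hs' hα

theorem IsAdmissible.le_cost (h : IsAdmissible f A t T x₀ x α)
    (D : ControlData T A f L Λ) (ht : 0 ≤ t) (htT : t ≤ T) {g : E n → ℝ} {C : ℝ}
    (hL : ∀ s ∈ Icc 0 T, ∀ x : E n, ∀ a ∈ A, C ≤ L s x a) (hg : ∀ x : E n, C ≤ g x) :
    (T - t) * C + C ≤ cost L g t T x α := by
  refine add_le_add ?_ (hg _)
  have := intervalIntegral.integral_mono_on htT intervalIntegrable_const
    (h.intervalIntegrable_cost D ht htT) fun s hs =>
      hL s ⟨ht.trans hs.1, hs.2⟩ (x s) (α s) (h.control_mem s hs)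
  simpa using this

end Comparison

end LaxFormula

theorem theorem2 {n m : ℕ} (T : ℝ)
    (A : Set (LaxFormula.E m)) (f : ℝ → LaxFormula.E n → LaxFormula.E m → LaxFormula.E n)
    (L : ℝ → LaxFormula.E n → LaxFormula.E m → ℝ) (g : LaxFormula.E n → ℝ)
    (Lf LL Lg C : ℝ)
    (hA : IsCompact A) (hA_ne : A.Nonempty)
    (hf : ∀ a ∈ A, ∀ s₁ ∈ Icc 0 T, ∀ s₂ ∈ Icc 0 T, ∀ x₁ x₂ : LaxFormula.E n,
      ‖f s₁ x₁ a - f s₂ x₂ a‖ ≤ Lf * (|s₁ - s₂| + ‖x₁ - x₂‖))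
    (hL : ∀ a ∈ A, ∀ s₁ ∈ Icc 0 T, ∀ s₂ ∈ Icc 0 T, ∀ x₁ x₂ : LaxFormula.E n,
      |L s₁ x₁ a - L s₂ x₂ a| ≤ LL * (|s₁ - s₂| + ‖x₁ - x₂‖))
    (hg : ∀ x₁ x₂ : LaxFormula.E n, |g x₁ - g x₂| ≤ Lg * ‖x₁ - x₂‖)
    (hf_cont : ∀ s ∈ Icc 0 T, ∀ x : LaxFormula.E n, ContinuousOn (f s x) A)
    (hL_cont : ∀ s ∈ Icc 0 T, ∀ x : LaxFormula.E n, ContinuousOn (L s x) A)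
    (hL_below : ∀ s ∈ Icc 0 T, ∀ x : LaxFormula.E n, ∀ a ∈ A, C ≤ L s x a)
    (hg_below : ∀ x : LaxFormula.E n, C ≤ g x) :
    ∀ t ∈ Icc 0 T, ∀ x₀ : LaxFormula.E n,
      -- both running costs are finite and integrable along admissible pairs
      (∀ x α, LaxFormula.IsAdmissible f A t T x₀ x α →
        IntervalIntegrable (fun s => L s (x s) (α s)) volume t T) ∧
      (∀ x β, LaxFormula.IsLaxAdmissible f A t T x₀ x β →
        (∀ s ∈ Icc t T, LaxFormula.hamiltonianConj f L A s (x s) (β s) ≠ ⊥ ∧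
          LaxFormula.hamiltonianConj f L A s (x s) (β s) ≠ ⊤) ∧
        IntervalIntegrable
          (fun s => (LaxFormula.hamiltonianConj f L A s (x s) (β s)).toReal) volume t T) ∧
      -- the value function is finite and equals the Lax formula
      LaxFormula.value f L g A T t x₀ ≠ ⊥ ∧
      LaxFormula.value f L g A T t x₀ ≠ ⊤ ∧
      LaxFormula.value f L g A T t x₀ = LaxFormula.laxValue f L g A T t x₀ := by
  -- No sign is assumed for the Lipschitz constants; this dominates both and is positive.
  have hΛ : 0 < |Lf| + |LL| + 1 := by positivity
  have D : LaxFormula.ControlData T A f L (|Lf| + |LL| + 1) := by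
    refine ⟨hΛ, hA, hA_ne, fun a ha s₁ h₁ s₂ h₂ x₁ x₂ => ?_, fun a ha s₁ h₁ s₂ h₂ x₁ x₂ => ?_,
      hf_cont, hL_cont⟩
    · refine (hf a ha s₁ h₁ s₂ h₂ x₁ x₂).trans (mul_le_mul_of_nonneg_right ?_ (by positivity))
      linarith [le_abs_self Lf, abs_nonneg LL]
    · refine (hL a ha s₁ h₁ s₂ h₂ x₁ x₂).trans (mul_le_mul_of_nonneg_right ?_ (by positivity))
      linarith [le_abs_self LL, abs_nonneg Lf]
  rintro t ⟨ht, htT⟩ x₀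
  refine ⟨fun x α h => h.intervalIntegrable_cost D ht htT, fun x β h => ⟨fun s hs => ?_,
    h.intervalIntegrable_conj D ht htT⟩, ?_, ?_, le_antisymm ?_ ?_⟩
  · have hs' : s ∈ Icc 0 T := ⟨ht.trans hs.1, hs.2⟩
    exact ⟨D.hamiltonianConj_ne_bot hs' _ _, D.hamiltonianConj_ne_top hs' (h.control_mem s hs)⟩
  · refine ((EReal.bot_lt_coe ((T - t) * C + C)).trans_le ?_).ne'
    exact le_iInf fun x => le_iInf fun α => le_iInf fun h =>
      EReal.coe_le_coe_iff.2 (h.le_cost D ht htT hL_below hg_below)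
  · obtain ⟨x, α, h⟩ := D.exists_isAdmissible ht htT x₀
    have hle : LaxFormula.value f L g A T t x₀ ≤ (LaxFormula.cost L g t T x α : EReal) :=
      iInf_le_of_le x (iInf_le_of_le α (iInf_le_of_le h le_rfl))
    exact (hle.trans_lt (EReal.coe_lt_top _)).ne
  · exact le_iInf fun x => le_iInf fun β => le_iInf fun h => h.value_le_laxCost D ht htT hg
  · exact le_iInf fun x => le_iInf fun α => le_iInf fun h =>
      iInf_le_of_le x (iInf_le_of_le _ (iInf_le_of_le h.isLaxAdmissible
        (EReal.coe_le_coe_iff.2 (h.laxCost_le_cost D ht htT g))))
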